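/- Let $k$ be an algebraically closed field and let $\Lambda=k\mathcal Q/\langle\rho\rangle$ be a string algebra over $k$: $\mathcal Q=(Q_0,Q_1,s,t)$ is a finite quiver, $\rho$ is a set of paths of positive length, only finitely many paths have no subpath in $\rho$, each vertex is the source of at most two and the target of at most two arrows, and for each arrow $b$ there is at most one arrow $c$ with $s(c)=t(b)$, $cb\notin\rho$ and at most one arrow $a$ with $t(a)=s(b)$, $ba\notin\rho$. Paths are read from right to left, and capital letters denote the formal inverses of arrows, with $s(B)=t(b)$ and $t(B)=s(b)$. Fix maps $\sigma,\varepsilon:Q_1\to\{1,-1\}$ such that $\sigma(b_1)=-\sigma(b_2)$ for arrows $b_1\ne b_2$ with the same source, $\varepsilon(c_1)=-\varepsilon(c_2)$ for arrows $c_1\neq c_2$ with the same target, and $\sigma(b)=-\varepsilon(c)$ whenever $s(b)=t(c)$ and $bc\notin\rho$; put $\sigma(B)=\varepsilon(b)$ and $\varepsilon(B)=\sigma(b)$. A string is either a lazy path $1_{(v,i)}$ ($v\in Q_0$, $i=\pm1$; $s=t=v$, $\sigma(1_{(v,i)})=-i$, $\varepsilon(1_{(v,i)})=i$), or a word $\alpha_n\cdots\alpha_1$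 in arrows and inverse arrows with $s(\alpha_{m+1})=t(\alpha_m)$, with no two neighbours inverse to each other, and such that neither a subword nor the inverse of a subword lies in $\rho$; in the latter case $s,\sigma$ are those of $\alpha_1$ and $t,\varepsilon$ those of $\alpha_n$. The products $\mathfrak u1_{(v,i)}=\mathfrak u$ and $1_{(v,i)}\mathfrak v=\mathfrak v$ are defined if $s(\mathfrak u)=v$, $\sigma(\mathfrak u)=-i$, respectively $t(\mathfrak v)=v$, $\varepsilon(\mathfrak v)=i$. Let $\mathrm M(\mathfrak u)$ be the string module of $\mathfrak u$. If $\mathfrak w=\mathfrak y\mathfrak v$ is a string and $\mathfrak y$ is empty or begins (next to $\mathfrak v$) with an inverse arrow, there is the canonical inclusion $\mathrm M(\mathfrak v)\to\mathrm M(\mathfrak w)$. For a string $\mathfrak v$ let $l(\mathfrak v)=\mathfrak yB\mathfrak v$, where $b$ is the arrow (unique if it exists) for which $B\mathfrak v$ is a string and $\mathfrak y$ is the direct string of maximal length for which $\mathfrak yB\mathfrak v$ is a string; $l_i(\mathfrak v)$ arises from $l(\mathfrak v)$ by deleting the last $i$ syllables of $\mathfrak y$, for $0\le i\le|\mathfrak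 y|$. Dually $\bar l(\mathfrak v)=\mathfrak ya\mathfrak v$ with an arrow $a$ and an inverse string $\mathfrak y$ of maximal length, and $\bar l_i(\mathfrak v)$ arises by deleting the last $i$ syllables of $\mathfrak y$. For partial maps $R,S$ on strings that extend strings on the left, $\langle1,R\rangle(\mathfrak v)$ is the limit of the words $R^n(\mathfrak v)$, if they all exist and their lengths are unbounded, and $\mathfrak y=\langle R,S\rangle(\mathfrak v)$ means: $\langle1,R\rangle(\mathfrak y)=\langle1,S\rangle(\mathfrak v)$, there is no string $\mathfrak x$ with $\mathfrak y=R(\mathfrak x)$, and $\mathfrak v$ is a proper initial (right hand) substring of $\mathfrak y$. An $l$-term is a finite composition $\tau$ of maps $l_i$ or a bracket $\langle\mu,\tau\rangle$, and an $\bar l$-term is a finite composition $\mu$ of maps $\bar l_j$ or a bracket $\langle\tau,\mu\rangle$, with $\tau$ and $\mu$ such finite compositions. An $l$-term $\tau$ together with a pair $(v,j)$ labels the canonical inclusion $\mathrm M(\mathfrak v)\to\mathrm M(\mathfrak x\mathfrak v)$, where $\mathfrak x=\tau(1_{(v,j)})$ and $\mathfrak v$ is any string with $t(\mathfrak v)=v$,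 $\varepsilon(\mathfrak v)=j$ such that $\mathfrak x\mathfrak v$ is a string (in particular $\mathrm M(1_{(v,j)})\to\mathrm M(\mathfrak x)$). The term $\tau=\tau(v,j)$ is recursive if $$\tau(1_{(v,j)})=\langle\mu,\tau_1\tau\tau_2\rangle(1_{(v,j)})$$ for some $l$-terms $\tau_1,\tau_2$ and some $\bar l$-term $\mu$, where the middle factor $\tau=\tau(v,j)$ is applied only to strings $\mathfrak z$ with $t(\mathfrak z)=v$ and $\varepsilon(\mathfrak z)=j$, by $\mathfrak z\mapsto\tau(1_{(v,j)})\,\mathfrak z$. Let $\mathrm{rad}$ be the ideal of the category of finite dimensional $\Lambda$-modules generated by the non-invertible morphisms between indecomposable modules. Let $\mathrm{rad}^0$ consist of all morphisms, let $\mathrm{rad}^n$ ($n\ge1$ finite) be the ideal generated by the compositions of $n$ morphisms in $\mathrm{rad}$, $\mathrm{rad}^\lambda=\bigcap_{\nu<\lambda}\mathrm{rad}^\nu$ for limit ordinals $\lambda$, and $\mathrm{rad}^{\lambda+n}=(\mathrm{rad}^\lambda)^{n+1}$ for limit ordinals $\lambda$ and $1\le n<\omega$. A morphism has rank $\infty$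 if it lies in $\mathrm{rad}^\nu$ for all ordinals $\nu$. **Lemma.** Let $f$ be a canonical inclusion between two distinct string modules of $\Lambda$ that is labelled by a recursive $l$-term $\tau=\tau(v,j)$. Then $\mathrm{rk}(f)=\infty$. -/

import Mathlib

open CategoryTheory

universe u v

/-! ### Powers of the radical of an additive category of modules, and ranks -/

section Ideals

variable {C : Type*} [Category C] [Preadditive C]

/-- A two-sided ideal of a preadditive category: a class of morphisms that contains the zero
morphisms, and is closed under addition and under composition with arbitrary morphisms. -/
structure IsCatIdeal (I : MorphismProperty C) : Prop where
  zero_mem : ∀ X Y : C, I (0 : X ⟶ Y)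
  add_mem : ∀ {X Y : C} (f g : X ⟶ Y), I f → I g → I (f + g)
  precomp : ∀ {X Y Z : C} (f : X ⟶ Y) (g : Y ⟶ Z), I g → I (f ≫ g)
  postcomp : ∀ {X Y Z : C} (f : X ⟶ Y) (g : Y ⟶ Z), I f → I (f ≫ g)

/-- The ideal generated by a class of morphisms. -/
def genIdeal (W : MorphismProperty C) : MorphismProperty C :=
  fun _ _ f => ∀ I : MorphismProperty C, IsCatIdeal I → W ≤ I → I f

/-- Compositions of `n` morphisms in `I`; for `n = 0` all morphisms, by convention. -/
def nFold (I : MorphismProperty C) : ℕ → MorphismProperty C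
  | 0 => ⊤
  | 1 => I
  | n + 2 => fun X Y f => ∃ (Z : C) (g : X ⟶ Z) (h : Z ⟶ Y), nFold I (n + 1) g ∧ I h ∧ g ≫ h = f

/-- The `n`-th power of an ideal: the ideal generated by the compositions of `n` of its
morphisms. -/
def powIdeal (I : MorphismProperty C) (n : ℕ) : MorphismProperty C :=
  genIdeal (nFold I n)

/-- Recursion data for the transfinite powers of an ideal `I`.  The value at `λ + n`, for `λ` zero
or a limit ordinal, is a pair `(J, m)` such that the power in question is the `m`-th power of `J`:
it is `(I, n)` for `λ = 0`, and `(⋂ of the earlier powers, n + 1)` for a limit `λ`. -/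
noncomputable def ordPowAux (I : MorphismProperty C) (ν : Ordinal.{u}) : MorphismProperty C × ℕ :=
  Ordinal.limitRecOn (motive := fun _ => MorphismProperty C × ℕ) ν (I, 0)
    (fun _ p => (p.1, p.2 + 1))
    (fun o _ F => ((fun _ _ f => ∀ (o' : Ordinal.{u}) (h : o' < o),
      powIdeal (F o' h).1 (F o' h).2 f), 1))

/-- The transfinite powers of an ideal `I`: the usual powers `I ^ n` for natural numbers `n`
(everything for `n = 0`), the intersection of the earlier powers at a limit ordinal `λ`, and
`(I ^ λ) ^ (n + 1)` at `λ + n`. These properties are proved below. -/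
noncomputable def ordPow (I : MorphismProperty C) (ν : Ordinal.{u}) : MorphismProperty C :=
  powIdeal (ordPowAux I ν).1 (ordPowAux I ν).2

theorem genIdeal_isCatIdeal (W : MorphismProperty C) : IsCatIdeal (genIdeal W) where
  zero_mem X Y _ hI _ := hI.zero_mem X Y
  add_mem f g hf hg I hI hW := hI.add_mem f g (hf I hI hW) (hg I hI hW)
  precomp f g hg I hI hW := hI.precomp f g (hg I hI hW)
  postcomp f g hf I hI hW := hI.postcomp f g (hf I hI hW)

theorem genIdeal_eq_self {I : MorphismProperty C} (hI : IsCatIdeal I) : genIdeal I = I :=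
  le_antisymm (fun _ _ _ hf => hf I hI le_rfl) (fun _ _ f hf _ _ hW => hW f hf)

theorem ordPow_isCatIdeal (I : MorphismProperty C) (ν : Ordinal.{u}) :
    IsCatIdeal (ordPow I ν) :=
  genIdeal_isCatIdeal _

theorem ordPowAux_add_nat (I : MorphismProperty C) (ν : Ordinal.{u}) (n : ℕ) :
    ordPowAux I (ν + n) = ((ordPowAux I ν).1, (ordPowAux I ν).2 + n) := by
  induction n with
  | zero => simp
  | succ n ih =>
    rw [Nat.cast_succ, ← add_assoc]
    unfold ordPowAux at ih ⊢
    rw [Ordinal.limitRecOn_add_one, ih]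
    simp [add_assoc]

theorem ordPow_zero (I : MorphismProperty C) : ordPow I (0 : Ordinal.{u}) = ⊤ := by
  have h : ordPowAux I (0 : Ordinal.{u}) = (I, 0) := by
    unfold ordPowAux; rw [Ordinal.limitRecOn_zero]
  unfold ordPow
  rw [h]
  exact le_antisymm (fun _ _ _ _ => trivial) (fun _ _ f hf _ _ hW => hW f hf)

theorem ordPow_nat (I : MorphismProperty C) (n : ℕ) :
    ordPow I (n : Ordinal.{u}) = powIdeal I n := by
  have h : ordPowAux I (0 : Ordinal.{u}) = (I, 0) := by
    unfold ordPowAux; rw [Ordinal.limitRecOn_zero]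
  have h2 := ordPowAux_add_nat I (0 : Ordinal.{u}) n
  rw [zero_add, h] at h2
  unfold ordPow
  rw [h2]
  simp

theorem ordPow_limit (I : MorphismProperty C) {ν : Ordinal.{u}} (hν : Order.IsSuccLimit ν) :
    ordPow I ν = fun _ _ f => ∀ ν' < ν, ordPow I ν' f := by
  have h : ordPowAux I ν = ((fun _ _ f => ∀ ν' < ν, ordPow I ν' f), 1) := by
    conv_lhs => unfold ordPowAux
    rw [Ordinal.limitRecOn_limit _ _ _ _ hν]
    rfl
  unfold ordPow
  rw [h]
  exact genIdeal_eq_self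
    { zero_mem := fun X Y ν' _ => (ordPow_isCatIdeal I ν').zero_mem X Y
      add_mem := fun f g hf hg ν' h' =>
        (ordPow_isCatIdeal I ν').add_mem f g (hf ν' h') (hg ν' h')
      precomp := fun f g hg ν' h' => (ordPow_isCatIdeal I ν').precomp f g (hg ν' h')
      postcomp := fun f g hf ν' h' => (ordPow_isCatIdeal I ν').postcomp f g (hf ν' h') }

theorem ordPow_limit_add (I : MorphismProperty C) {ν : Ordinal.{u}} (hν : Order.IsSuccLimit ν)
    (n : ℕ) : ordPow I (ν + n) = powIdeal (ordPow I ν) (n + 1) := by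
  have h : ordPowAux I ν = (ordPow I ν, 1) := by
    rw [ordPow_limit I hν]
    conv_lhs => unfold ordPowAux
    rw [Ordinal.limitRecOn_limit _ _ _ _ hν]
    rfl
  conv_lhs => unfold ordPow
  rw [ordPowAux_add_nat, h, add_comm]

/-- The rank of a morphism with respect to the transfinite powers of an ideal `I`: it is `⊤`
(that is, `∞`) if the morphism lies in all powers, and otherwise the ordinal `ν` such that the
morphism lies in the `ν`-th but not in the `(ν + 1)`-st power. -/
noncomputable def idealRank (I : MorphismProperty C) {X Y : C} (f : X ⟶ Y) :
    WithTop Ordinal.{u} :=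
  open Classical in
  if ∀ ν : Ordinal.{u}, ordPow I ν f then ⊤
  else ((sInf {ν : Ordinal.{u} | ordPow I ν f ∧ ¬ ordPow I (ν + 1) f} : Ordinal.{u}) :
    WithTop Ordinal.{u})

end Ideals

/-! ### String algebras and strings -/

/-- Syllables: arrows `b` and their formal inverses `B`. -/
inductive Syl (E : Type v) : Type v
  | dir (b : E) : Syl E
  | inv (b : E) : Syl E

/-- The formal inverse of a syllable. -/
def Syl.inverse {E : Type v} : Syl E → Syl E
  | .dir b => .inv b
  | .inv b => .dir b

/-- The data of a string algebra with vertices `V` and arrows `E`: a quiver, a set `rel` of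
monomial relations, and a choice of the maps `σ`, `ε`.  A path `b_n ⋯ b_2 b_1` (first `b_1`, then
`b_2`, and so on) is encoded as the list `[b_1, b_2, …, b_n]`. -/
structure StringAlgebra (V E : Type v) where
  src : E → V
  tgt : E → V
  rel : Set (List E)
  rel_ne_nil : ∀ r ∈ rel, r ≠ []
  rel_isPath : ∀ r ∈ rel, r.IsChain (fun b c => src c = tgt b)
  finite_paths : {p : List E | p.IsChain (fun b c => src c = tgt b) ∧
    ∀ r ∈ rel, ¬ r <:+: p}.Finite
  src_le_two : ∀ w : V, {b : E | src b = w}.encard ≤ 2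
  tgt_le_two : ∀ w : V, {b : E | tgt b = w}.encard ≤ 2
  unique_after : ∀ b : E, {c : E | src c = tgt b ∧ [b, c] ∉ rel}.Subsingleton
  unique_before : ∀ b : E, {a : E | tgt a = src b ∧ [a, b] ∉ rel}.Subsingleton
  σ : E → ℤˣ
  ε : E → ℤˣ
  σ_ne : ∀ b₁ b₂ : E, b₁ ≠ b₂ → src b₁ = src b₂ → σ b₁ = -σ b₂
  ε_ne : ∀ c₁ c₂ : E, c₁ ≠ c₂ → tgt c₁ = tgt c₂ → ε c₁ = -ε c₂
  σ_eq : ∀ b c : E, src b = tgt c → [c, b] ∉ rel → σ b = -ε c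

namespace StringAlgebra

variable {V E : Type v} (A : StringAlgebra V E)

/-- Source of a syllable. -/
def sylSrc : Syl E → V
  | .dir b => A.src b
  | .inv b => A.tgt b

/-- Target of a syllable. -/
def sylTgt : Syl E → V
  | .dir b => A.tgt b
  | .inv b => A.src b

/-- `σ` on syllables. -/
def sylσ : Syl E → ℤˣ
  | .dir b => A.σ b
  | .inv b => A.ε b

/-- `ε` on syllables. -/
def sylε : Syl E → ℤˣ
  | .dir b => A.ε b
  | .inv b => A.σ b

/-- A string `𝔲 = α_n ⋯ α_2 α_1`, encoded by the list `syls = [α_1, α_2, …, α_n]` of its syllables,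
together with the unique pair `(base, sgn) = (v, i)` such that the composition `𝔲 1_{(v,i)}` is
defined, i.e. `s(𝔲) = v` and `σ(𝔲) = -i`.  For `n ≥ 1` this pair is determined by `α_1`; for
`n = 0` the string is the lazy path `1_{(v,i)}`. -/
@[ext]
structure Str where
  base : V
  sgn : ℤˣ
  syls : List (Syl E)
  head_ok : ∀ α ∈ syls.head?, A.sylSrc α = base ∧ A.sylσ α = -sgn
  chain_ok : syls.IsChain (fun α β => A.sylSrc β = A.sylTgt α ∧ β ≠ α.inverse)
  no_rel : ∀ r ∈ A.rel, ¬ r.map Syl.dir <:+: syls ∧ ¬ r.reverse.map Syl.inv <:+: syls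

variable {A}

namespace Str

/-- The length of a string. -/
def len (𝔲 : A.Str) : ℕ := 𝔲.syls.length

/-- The target `t(𝔲)`. -/
def endVertex (𝔲 : A.Str) : V := 𝔲.syls.getLast?.elim 𝔲.base A.sylTgt

/-- The sign `ε(𝔲)`. -/
def endSgn (𝔲 : A.Str) : ℤˣ := 𝔲.syls.getLast?.elim 𝔲.sgn A.sylε

/-- `𝔳` is an initial (right hand) substring of `𝔴`, i.e. `𝔴 = 𝔶𝔳` for some `𝔶`. -/
def IsInitial (𝔳 𝔴 : A.Str) : Prop :=
  𝔳.base = 𝔴.base ∧ 𝔳.sgn = 𝔴.sgn ∧ 𝔳.syls <+: 𝔴.syls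

/-- `𝔳` is an initial substring and an image substring of `𝔴`: in `𝔴` it is followed by an inverse
syllable, or by nothing. -/
def IsInitialImage (𝔳 𝔴 : A.Str) : Prop :=
  𝔳.IsInitial 𝔴 ∧ ∀ α ∈ 𝔴.syls[𝔳.len]?, ∃ b, α = Syl.inv b

/-- `𝔴 = 𝔵𝔳`, where the composition `1_{(v,i)} 𝔳` with the lazy path at which `𝔵` begins is
defined. -/
def IsConcat (𝔵 𝔳 𝔴 : A.Str) : Prop :=
  𝔳.endVertex = 𝔵.base ∧ 𝔳.endSgn = 𝔵.sgn ∧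
    𝔴.base = 𝔳.base ∧ 𝔴.sgn = 𝔳.sgn ∧ 𝔴.syls = 𝔳.syls ++ 𝔵.syls

end Str

variable (A) in
/-- The lazy path `1_{(v,i)}`. -/
def lazy (w : V) (i : ℤˣ) : A.Str where
  base := w
  sgn := i
  syls := []
  head_ok := by simp
  chain_ok := by simp
  no_rel r hr := by simpa using A.rel_ne_nil r hr

/-! ### Terms -/

/-- For `p = inv`, `q = dir`: `𝔴 = l_i(𝔳)`.  Here `l(𝔳) = 𝔶 B 𝔳` with `b` an arrow and `𝔶` the direct
string of maximal length such that `𝔶 B 𝔳` is a string, and `l_i(𝔳)` is obtained from `l(𝔳)` by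
deleting the last `i` syllables of `𝔶`.  For `p = dir`, `q = inv`: likewise `𝔴 = l̄_i(𝔳)`, with
`l̄(𝔳) = 𝔶 a 𝔳`, `a` an arrow and `𝔶` an inverse string of maximal length. -/
def Step (p q : E → Syl E) (i : ℕ) (𝔳 𝔴 : A.Str) : Prop :=
  ∃ (b : E) (y : List E) (𝔷 : A.Str),
    𝔷.base = 𝔳.base ∧ 𝔷.sgn = 𝔳.sgn ∧ 𝔷.syls = 𝔳.syls ++ p b :: y.map q ∧
    (∀ (y' : List E) (𝔷' : A.Str), 𝔷'.base = 𝔳.base → 𝔷'.sgn = 𝔳.sgn →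
      𝔷'.syls = 𝔳.syls ++ p b :: y'.map q → y'.length ≤ y.length) ∧
    i ≤ y.length ∧
    𝔴.base = 𝔳.base ∧ 𝔴.sgn = 𝔳.sgn ∧
    𝔴.syls = 𝔳.syls ++ p b :: (y.take (y.length - i)).map q

/-- The value at `𝔳` of the composition of a list of (partial) maps, head of the list first. -/
def Steps (R : ℕ → A.Str → A.Str → Prop) : List ℕ → A.Str → A.Str → Prop
  | [], 𝔳, 𝔴 => 𝔳 = 𝔴
  | i :: is, 𝔳, 𝔴 => ∃ 𝔷, R i 𝔳 𝔷 ∧ Steps R is 𝔷 𝔴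

variable (A) in
/-- `𝔴` is the value at `𝔳` of the composition `l_{i_n} ⋯ l_{i_2} l_{i_1}`, for `is = [i_1, …, i_n]`. -/
def LSteps (is : List ℕ) (𝔳 𝔴 : A.Str) : Prop := Steps (Step Syl.inv Syl.dir) is 𝔳 𝔴

variable (A) in
/-- `𝔴` is the value at `𝔳` of the composition `l̄_{i_n} ⋯ l̄_{i_2} l̄_{i_1}`, for
`is = [i_1, …, i_n]`. -/
def LbarSteps (is : List ℕ) (𝔳 𝔴 : A.Str) : Prop := Steps (Step Syl.dir Syl.inv) is 𝔳 𝔴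

/-- `⟨1, R⟩(𝔳) = W`: the iterates of the partial map `R` on `𝔳` exist, and form an increasing sequence
of initial substrings with limit the left `ℕ`-string `W = ⋯ W_1 W_0`. -/
def IsLimit (R : A.Str → A.Str → Prop) (𝔳 : A.Str) (W : ℕ → Syl E) : Prop :=
  ∃ s : ℕ → A.Str, s 0 = 𝔳 ∧ (∀ n, R (s n) (s (n + 1))) ∧
    (∀ n i, ∀ α ∈ (s n).syls[i]?, W i = α) ∧ ∀ N, ∃ n, N ≤ (s n).len

/-- `𝔶 = ⟨R, S⟩(𝔳)`: the string `𝔶` is a solution of `⟨1, R⟩(𝔶) = ⟨1, S⟩(𝔳)` which is fundamental, in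
the sense that `R(𝔵) = 𝔶` has no solution `𝔵`, and `𝔳` is a proper initial substring of `𝔶`. -/
def Bracket (R S : A.Str → A.Str → Prop) (𝔳 𝔶 : A.Str) : Prop :=
  (∃ W : ℕ → Syl E, IsLimit S 𝔳 W ∧ IsLimit R 𝔶 W) ∧ (∀ 𝔵, ¬ R 𝔵 𝔶) ∧ 𝔳.IsInitial 𝔶 ∧ 𝔳 ≠ 𝔶

end StringAlgebra

/-- `l`-terms: finite compositions `τ` of some `l_i`, and brackets `⟨μ, τ⟩` of a finite composition
`μ` of some `l̄_j` with a finite composition `τ` of some `l_i` (listed in the order in which they are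
applied). -/
inductive LTerm
  | comp (τ : List ℕ) : LTerm
  | brac (μ τ : List ℕ) : LTerm

/-- `l̄`-terms: finite compositions `μ` of some `l̄_j`, and brackets `⟨τ, μ⟩`. -/
inductive LbarTerm
  | comp (μ : List ℕ) : LbarTerm
  | brac (τ μ : List ℕ) : LbarTerm

namespace StringAlgebra

variable {V E : Type v} (A : StringAlgebra V E)

/-- `𝔴 = τ(𝔳)`, for an `l`-term `τ`. -/
def LTermVal : LTerm → A.Str → A.Str → Prop
  | .comp τ => A.LSteps τ
  | .brac μ τ => Bracket (A.LbarSteps μ) (A.LSteps τ)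

/-- `𝔴 = μ(𝔳)`, for an `l̄`-term `μ`. -/
def LbarTermVal : LbarTerm → A.Str → A.Str → Prop
  | .comp μ => A.LbarSteps μ
  | .brac τ μ => Bracket (A.LSteps τ) (A.LbarSteps μ)

/-- The term `τ(v,j)` with value `τ(1_{(v,j)}) = 𝔵` labels the canonical inclusion `M(𝔳) → M(𝔴)`:
the string `𝔳` ends at `v` with sign `ε(𝔳) = j`, and `𝔴 = 𝔵𝔳`. (Thus the label does not change if the
strings are extended on the right; the case `𝔳 = 1_{(v,j)}`, `𝔴 = 𝔵` is included.) -/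
def Labels (τ : LTerm) (w : V) (j : ℤˣ) (𝔵 𝔳 𝔴 : A.Str) : Prop :=
  A.LTermVal τ (A.lazy w j) 𝔵 ∧ 𝔵.IsConcat 𝔳 𝔴

/-- The term `τ(v,j)`, with value `τ(1_{(v,j)}) = 𝔵`, is recursive: there are `l`-terms `τ₁`, `τ₂` and
an `l̄`-term `μ` such that `𝔵 = ⟨μ, τ₁ τ τ₂⟩(1_{(v,j)})`. The middle factor of `τ₁ τ τ₂` is the labelled
term `τ(v,j)`, and so it applies to strings that end at `v` with sign `j`. -/
def IsRecursive (τ : LTerm) (w : V) (j : ℤˣ) (𝔵 : A.Str) : Prop :=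
  A.LTermVal τ (A.lazy w j) 𝔵 ∧
  ∃ (τ₁ τ₂ : LTerm) (μ : LbarTerm),
    Bracket (A.LbarTermVal μ)
      (fun 𝔞 𝔡 => ∃ 𝔟 𝔠, A.LTermVal τ₂ 𝔞 𝔟 ∧ A.Labels τ w j 𝔵 𝔟 𝔠 ∧ A.LTermVal τ₁ 𝔠 𝔡)
      (A.lazy w j) 𝔵

/-! ### The algebra, its modules, string modules -/

section Modules

variable (k : Type u) [Field k]

variable {A}

namespace Str

/-- The vertex at position `m` of a string, for `0 ≤ m ≤ 𝔲.len`. -/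
def vtx (𝔲 : A.Str) : ℕ → V
  | 0 => 𝔲.base
  | m + 1 => 𝔲.syls[m]?.elim 𝔲.base A.sylTgt

/-- The underlying space of the string module `M(𝔲)`, with basis `z_0, …, z_n` for `n = 𝔲.len`. -/
def Mod (𝔲 : A.Str) : Type u := Fin (𝔲.len + 1) → k

instance (𝔲 : A.Str) : AddCommGroup (𝔲.Mod k) := inferInstanceAs (AddCommGroup (_ → k))

instance (𝔲 : A.Str) : Module k (𝔲.Mod k) := inferInstanceAs (Module k (_ → k))

/-- The basis of `M(𝔲)`. -/
noncomputable def stdBasis (𝔲 : A.Str) : Module.Basis (Fin (𝔲.len + 1)) k (𝔲.Mod k) :=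
  Pi.basisFun k _

/-- The basis vector `z_m` of `M(𝔲)` (zero if `m` is out of range). -/
noncomputable def z (𝔲 : A.Str) (m : ℕ) : 𝔲.Mod k :=
  if h : m < 𝔲.len + 1 then 𝔲.stdBasis k ⟨m, h⟩ else 0

open Classical in
/-- The action of the generators of `Λ` on `M(𝔲)`, where `𝔲 = α_n ⋯ α_1`:
`e_v z_m` is `z_m` if `v` is the vertex at position `m`, and `0` otherwise;
`b z_m` is `z_{m+1}` if `α_{m+1} = b`, is `z_{m-1}` if `α_m = B`, and is `0` otherwise. -/
noncomputable def genAct (𝔲 : A.Str) : V ⊕ E → Module.End k (𝔲.Mod k)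
  | .inl w => (𝔲.stdBasis k).constr k fun m => if 𝔲.vtx m = w then 𝔲.z k m else 0
  | .inr b => (𝔲.stdBasis k).constr k fun m =>
      (if 𝔲.syls[(m : ℕ)]? = some (.dir b) then 𝔲.z k (m + 1) else 0) +
      (if 0 < (m : ℕ) ∧ 𝔲.syls[(m : ℕ) - 1]? = some (.inv b) then 𝔲.z k (m - 1) else 0)

theorem vtx_src (𝔲 : A.Str) {i : ℕ} {α : Syl E} (h : 𝔲.syls[i]? = some α) :
    𝔲.vtx i = A.sylSrc α := by
  cases i with
  | zero =>
    have := 𝔲.head_ok α (by rw [List.head?_eq_getElem?]; exact h)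
    exact this.1.symm
  | succ i =>
    obtain ⟨hi, rfl⟩ := List.getElem?_eq_some_iff.1 h
    have hc := (List.isChain_iff_getElem.1 𝔲.chain_ok) i hi
    simp [vtx, List.getElem?_eq_getElem (Nat.lt_of_succ_lt hi), hc.1]

theorem vtx_tgt (𝔲 : A.Str) {i : ℕ} {α : Syl E} (h : 𝔲.syls[i]? = some α) :
    𝔲.vtx (i + 1) = A.sylTgt α := by
  simp [vtx, h]

theorem z_of_lt (𝔲 : A.Str) {m : ℕ} (h : m < 𝔲.len + 1) : 𝔲.z k m = 𝔲.stdBasis k ⟨m, h⟩ := by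
  simp [z, h]

open Classical in
theorem genAct_inl_z (𝔲 : A.Str) (w : V) (m : ℕ) :
    𝔲.genAct k (.inl w) (𝔲.z k m) = if 𝔲.vtx m = w then 𝔲.z k m else 0 := by
  by_cases h : m < 𝔲.len + 1
  · rw [z_of_lt k 𝔲 h, genAct, Module.Basis.constr_basis, z_of_lt k 𝔲 h]
  · simp [z, h]

open Classical in
theorem genAct_inr_z (𝔲 : A.Str) (b : E) (m : ℕ) :
    𝔲.genAct k (.inr b) (𝔲.z k m) =
      (if 𝔲.syls[m]? = some (.dir b) then 𝔲.z k (m + 1) else 0) +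
      (if 0 < m ∧ 𝔲.syls[m - 1]? = some (.inv b) then 𝔲.z k (m - 1) else 0) := by
  by_cases h : m < 𝔲.len + 1
  · rw [z_of_lt k 𝔲 h, genAct, Module.Basis.constr_basis]
  · have h1 : 𝔲.syls[m]? = none := List.getElem?_eq_none (by unfold len at h; omega)
    have h2 : 𝔲.syls[m - 1]? = none := List.getElem?_eq_none (by unfold len at h; omega)
    rw [h1, h2]
    simp [z, h]

theorem end_ext {𝔲 : A.Str} {M : Type*} [AddCommGroup M] [Module k M] {f g : 𝔲.Mod k →ₗ[k] M}
    (h : ∀ m, f (𝔲.z k m) = g (𝔲.z k m)) : f = g := by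
  refine (𝔲.stdBasis k).ext fun m => ?_
  rw [← z_of_lt k 𝔲 m.2]
  exact h m

open Classical in
theorem path_act_ne_zero (𝔲 : A.Str) (r : List E) (hr : r ≠ []) (m : ℕ)
    (h : (r.reverse.map fun b => 𝔲.genAct k (.inr b)).prod (𝔲.z k m) ≠ 0) :
    r.map Syl.dir <:+: 𝔲.syls ∧ r.map Syl.dir <+: 𝔲.syls.drop m ∨
      r.reverse.map Syl.inv <:+: 𝔲.syls ∧ r.reverse.map Syl.inv <:+ 𝔲.syls.take m := by
  suffices H : r.map Syl.dir <+: 𝔲.syls.drop m ∨ r.reverse.map Syl.inv <:+ 𝔲.syls.take m by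
    rcases H with H | H
    · exact Or.inl ⟨H.isInfix.trans (List.drop_suffix _ _).isInfix, H⟩
    · exact Or.inr ⟨H.isInfix.trans (List.take_prefix _ _).isInfix, H⟩
  induction r generalizing m with
  | nil => exact absurd rfl hr
  | cons b r ih =>
    simp only [List.reverse_cons, List.map_append, List.map_cons, List.map_nil, List.prod_append,
      List.prod_cons, List.prod_nil, mul_one, Module.End.mul_apply] at h
    rw [genAct_inr_z, map_add] at h
    have hcase : (𝔲.syls[m]? = some (.dir b) ∧
        (r.reverse.map fun b => 𝔲.genAct k (.inr b)).prod (𝔲.z k (m + 1)) ≠ 0) ∨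
        ((0 < m ∧ 𝔲.syls[m - 1]? = some (.inv b)) ∧
        (r.reverse.map fun b => 𝔲.genAct k (.inr b)).prod (𝔲.z k (m - 1)) ≠ 0) := by
      by_contra hcon
      push Not at hcon
      apply h
      have e1 : ∀ (P : Prop) [Decidable P] (F : Module.End k (𝔲.Mod k)) (x : 𝔲.Mod k),
          (P → F x = 0) → F (if P then x else 0) = 0 := by
        intro P _ F x hx
        split_ifs with hP
        · exact hx hP
        · exact map_zero F
      rw [e1 _ _ _ hcon.1, e1 _ _ _ hcon.2, add_zero]
    rcases hcase with ⟨hm, hne⟩ | ⟨⟨hm0, hm⟩, hne⟩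
    · left
      obtain ⟨hlt, hget⟩ := List.getElem?_eq_some_iff.1 hm
      rw [List.drop_eq_getElem_cons hlt, hget, List.map_cons]
      refine (List.prefix_cons_inj _).2 ?_
      by_cases hr' : r = []
      · simp [hr']
      rcases ih hr' (m + 1) hne with H | H
      · exact H
      · exfalso
        obtain ⟨c, r', rfl⟩ := List.exists_cons_of_ne_nil hr'
        rw [List.take_succ_eq_append_getElem hlt, hget, List.reverse_cons, List.map_append,
          List.map_cons, List.map_nil] at H
        have := List.IsSuffix.getLast (hx := by simp) H
        simp at this
    · right
      obtain ⟨n, rfl⟩ : ∃ n, m = n + 1 := ⟨m - 1, by omega⟩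
      simp only [Nat.add_sub_cancel] at hm hne
      obtain ⟨hlt, hget⟩ := List.getElem?_eq_some_iff.1 hm
      rw [List.take_succ_eq_append_getElem hlt, hget, List.reverse_cons, List.map_append,
        List.map_cons, List.map_nil]
      suffices r.reverse.map Syl.inv <:+ 𝔲.syls.take n by
        obtain ⟨t, ht⟩ := this
        exact ⟨t, by rw [← ht, List.append_assoc]⟩
      by_cases hr' : r = []
      · simp [hr']
      rcases ih hr' n hne with H | H
      · exfalso
        obtain ⟨c, r', rfl⟩ := List.exists_cons_of_ne_nil hr'
        rw [List.drop_eq_getElem_cons hlt, hget, List.map_cons, List.cons_prefix_cons] at H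
        simp at H
      · exact H

/-- The linear map underlying the canonical inclusion, `z_m ↦ z_m`. -/
noncomputable def inclusionₗ (𝔳 𝔴 : A.Str) : 𝔳.Mod k →ₗ[k] 𝔴.Mod k :=
  (𝔳.stdBasis k).constr k fun m => 𝔴.z k m

theorem inclusionₗ_z (𝔳 𝔴 : A.Str) {m : ℕ} (h : m < 𝔳.len + 1) :
    inclusionₗ k 𝔳 𝔴 (𝔳.z k m) = 𝔴.z k m := by
  rw [z_of_lt k 𝔳 h, inclusionₗ, Module.Basis.constr_basis]

theorem IsInitial.getElem? {𝔳 𝔴 : A.Str} (h : 𝔳.IsInitial 𝔴) {m : ℕ} (hm : m < 𝔳.len) :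
    𝔴.syls[m]? = 𝔳.syls[m]? := by
  obtain ⟨t, ht⟩ := h.2.2
  rw [← ht, List.getElem?_append_left hm]

theorem IsInitial.vtx {𝔳 𝔴 : A.Str} (h : 𝔳.IsInitial 𝔴) {m : ℕ} (hm : m < 𝔳.len + 1) :
    𝔴.vtx m = 𝔳.vtx m := by
  cases m with
  | zero => exact h.1.symm
  | succ m =>
    rw [Str.vtx, Str.vtx, h.getElem? (by omega), h.1]

theorem inclusionₗ_genAct {𝔳 𝔴 : A.Str} (h : 𝔳.IsInitialImage 𝔴) (g : V ⊕ E) :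
    inclusionₗ k 𝔳 𝔴 ∘ₗ 𝔳.genAct k g = 𝔴.genAct k g ∘ₗ inclusionₗ k 𝔳 𝔴 := by
  classical
  refine end_ext k fun m => ?_
  rw [LinearMap.comp_apply, LinearMap.comp_apply]
  by_cases hm : m < 𝔳.len + 1
  swap
  · simp [z, hm]
  rw [inclusionₗ_z k 𝔳 𝔴 hm]
  cases g with
  | inl w =>
    rw [genAct_inl_z, genAct_inl_z, h.1.vtx hm, apply_ite (inclusionₗ k 𝔳 𝔴), map_zero,
      inclusionₗ_z k 𝔳 𝔴 hm]
  | inr b =>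
    rw [genAct_inr_z, genAct_inr_z, map_add, apply_ite (inclusionₗ k 𝔳 𝔴),
      apply_ite (inclusionₗ k 𝔳 𝔴), map_zero]
    congr 1
    · rcases Nat.lt_or_ge m 𝔳.len with hlt | hge
      · rw [h.1.getElem? hlt, inclusionₗ_z k 𝔳 𝔴 (by omega)]
      · obtain rfl : m = 𝔳.len := by omega
        rw [if_neg, if_neg]
        · intro h'
          obtain ⟨c, hc⟩ := h.2 _ h'
          simp at hc
        · rw [List.getElem?_eq_none (by unfold len; omega)]
          simp
    · rcases Nat.eq_zero_or_pos m with rfl | hpos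
      · simp
      · rw [h.1.getElem? (show m - 1 < 𝔳.len by omega), inclusionₗ_z k 𝔳 𝔴 (by omega)]

end Str

variable (A) [Fintype V]

/-- The defining relations of `kQ/⟨ρ⟩` on the generators `e_v` (lazy paths) and `b` (arrows). -/
inductive AlgRel : FreeAlgebra k (V ⊕ E) → FreeAlgebra k (V ⊕ E) → Prop
  | idem (w : V) : AlgRel (FreeAlgebra.ι k (.inl w) * FreeAlgebra.ι k (.inl w))
      (FreeAlgebra.ι k (.inl w))
  | orth (w w' : V) (h : w ≠ w') :
      AlgRel (FreeAlgebra.ι k (.inl w) * FreeAlgebra.ι k (.inl w')) 0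
  | sum_one : AlgRel (∑ w : V, FreeAlgebra.ι k (.inl w)) 1
  | tgt_mul (b : E) : AlgRel (FreeAlgebra.ι k (.inl (A.tgt b)) * FreeAlgebra.ι k (.inr b))
      (FreeAlgebra.ι k (.inr b))
  | mul_src (b : E) : AlgRel (FreeAlgebra.ι k (.inr b) * FreeAlgebra.ι k (.inl (A.src b)))
      (FreeAlgebra.ι k (.inr b))
  | monomial (r : List E) (h : r ∈ A.rel) :
      AlgRel (r.reverse.map (fun b => FreeAlgebra.ι k (.inr b))).prod 0

/-- The algebra `Λ = kQ/⟨ρ⟩`, where the product `c b` in `kQ` is the path `b` followed by `c`. -/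
abbrev Alg : Type (max u v) := RingQuot (A.AlgRel k)

/-- The category of finite dimensional `Λ`-modules (i.e. finite dimensional representations of the
quiver with relations, where an arrow `b` acts from the component at `s(b)` to that at `t(b)`). -/
abbrev FinMod :=
  ObjectProperty.FullSubcategory (C := ModuleCat.{u} (A.Alg k))
    (fun M => Module.Finite k (RestrictScalars k (A.Alg k) M))

variable {A} {k} in
/-- Indecomposable modules: non-zero, and not a direct sum of two non-zero submodules. -/
def IsIndec (M : A.FinMod k) : Prop :=
  Nontrivial M.obj ∧ ∀ P Q : Submodule (A.Alg k) M.obj, IsCompl P Q → P = ⊥ ∨ Q = ⊥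

/-- The radical of the category of finite dimensional modules: the ideal generated by the
non-invertible morphisms between indecomposable modules. -/
def radical : MorphismProperty (A.FinMod k) :=
  genIdeal fun X Y f => IsIndec X ∧ IsIndec Y ∧ ¬ IsIso f

variable {A} {k} in
/-- The rank of a morphism of finite dimensional modules. -/
noncomputable def rk {X Y : A.FinMod k} (f : X ⟶ Y) : WithTop Ordinal.{u} :=
  idealRank (A.radical k) f

variable {A}

namespace Str

/-- The representation of `Λ` on `M(𝔲)`. -/
noncomputable def rep (𝔲 : A.Str) : A.Alg k →ₐ[k] Module.End k (𝔲.Mod k) :=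
  RingQuot.liftAlgHom k ⟨FreeAlgebra.lift k (𝔲.genAct k), by
    intro x y hxy
    classical
    induction hxy with
    | idem w =>
      refine end_ext k fun m => ?_
      simp only [map_mul, FreeAlgebra.lift_ι_apply, Module.End.mul_apply, genAct_inl_z]
      split_ifs with h
      · rw [genAct_inl_z, if_pos h]
      · exact map_zero _
    | orth w w' hne =>
      refine end_ext k fun m => ?_
      simp only [map_mul, map_zero, FreeAlgebra.lift_ι_apply, Module.End.mul_apply, genAct_inl_z]
      split_ifs with h
      · rw [genAct_inl_z, if_neg (fun h' => hne (h'.symm.trans h))]; rfl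
      · exact map_zero _
    | sum_one =>
      refine end_ext k fun m => ?_
      simp [map_sum, LinearMap.sum_apply, genAct_inl_z]
    | tgt_mul b =>
      refine end_ext k fun m => ?_
      simp only [map_mul, FreeAlgebra.lift_ι_apply, Module.End.mul_apply, genAct_inr_z, map_add]
      congr 1
      · split_ifs with h
        · rw [genAct_inl_z, if_pos (show 𝔲.vtx (m + 1) = A.tgt b from 𝔲.vtx_tgt h)]
        · exact map_zero _
      · split_ifs with h
        · rw [genAct_inl_z, if_pos (show 𝔲.vtx (m - 1) = A.tgt b from 𝔲.vtx_src h.2)]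
        · exact map_zero _
    | mul_src b =>
      refine end_ext k fun m => ?_
      simp only [map_mul, FreeAlgebra.lift_ι_apply, Module.End.mul_apply, genAct_inl_z]
      split_ifs with h
      · rfl
      · rw [map_zero, genAct_inr_z, if_neg, if_neg, add_zero]
        · rintro ⟨h0, h1⟩
          apply h
          obtain ⟨n, rfl⟩ : ∃ n, m = n + 1 := ⟨m - 1, by omega⟩
          exact 𝔲.vtx_tgt h1
        · intro h1
          exact h (𝔲.vtx_src h1)
    | monomial r hr =>
      refine end_ext k fun m => ?_
      rw [map_zero, map_list_prod, List.map_map]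
      by_contra hne
      have hc : ((FreeAlgebra.lift k (𝔲.genAct k)) ∘ fun b => FreeAlgebra.ι k (Sum.inr b)) =
          fun b : E => 𝔲.genAct k (Sum.inr b) := by
        funext b; simp
      rw [hc] at hne
      rcases path_act_ne_zero k 𝔲 r (A.rel_ne_nil r hr) m hne with H | H
      · exact (𝔲.no_rel r hr).1 H.1
      · exact (𝔲.no_rel r hr).2 H.1⟩

noncomputable instance (𝔲 : A.Str) : Module (A.Alg k) (𝔲.Mod k) :=
  Module.compHom (𝔲.Mod k) (𝔲.rep k).toRingHom

variable {k} in
theorem smul_def (𝔲 : A.Str) (a : A.Alg k) (x : 𝔲.Mod k) : a • x = 𝔲.rep k a x := rfl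

/-- The string module `M(𝔲)`. -/
noncomputable def stringModule (𝔲 : A.Str) : A.FinMod k where
  obj := ModuleCat.of (A.Alg k) (𝔲.Mod k)
  property := by
    have : Module.Finite k (𝔲.Mod k) := Module.Finite.of_basis (𝔲.stdBasis k)
    let F : 𝔲.Mod k →ₗ[k] RestrictScalars k (A.Alg k) (𝔲.Mod k) :=
      { toFun := fun x => (RestrictScalars.addEquiv k (A.Alg k) (𝔲.Mod k)).symm x
        map_add' := fun x y => rfl
        map_smul' := fun c x => by
          rw [RingHom.id_apply, ← RestrictScalars.addEquiv_symm_map_algebraMap_smul, smul_def 𝔲,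
            AlgHom.commutes]
          rfl }
    exact Module.Finite.of_surjective F fun x => ⟨x, rfl⟩

theorem inclusionₗ_rep {𝔳 𝔴 : A.Str} (h : 𝔳.IsInitialImage 𝔴) (a : A.Alg k) :
    inclusionₗ k 𝔳 𝔴 ∘ₗ 𝔳.rep k a = 𝔴.rep k a ∘ₗ inclusionₗ k 𝔳 𝔴 := by
  obtain ⟨a, rfl⟩ := RingQuot.mkAlgHom_surjective k _ a
  simp only [rep, RingQuot.liftAlgHom_mkAlgHom_apply]
  induction a using FreeAlgebra.induction with
  | grade0 r => ext x; simp
  | grade1 g => simpa using inclusionₗ_genAct k h g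
  | mul a b ha hb =>
    rw [map_mul, map_mul, Module.End.mul_eq_comp, Module.End.mul_eq_comp, ← LinearMap.comp_assoc,
      ha, LinearMap.comp_assoc, hb, LinearMap.comp_assoc]
  | add a b ha hb => rw [map_add, map_add, LinearMap.comp_add, LinearMap.add_comp, ha, hb]

/-- The canonical inclusion `M(𝔳) → M(𝔴)` for an image substring `𝔳` of `𝔴` that is an initial
substring of `𝔴`: it sends `z_m` to `z_m` for `0 ≤ m ≤ 𝔳.len`. -/
noncomputable def canonicalInclusion {𝔳 𝔴 : A.Str} (h : 𝔳.IsInitialImage 𝔴) :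
    𝔳.stringModule k ⟶ 𝔴.stringModule k :=
  ObjectProperty.homMk (ModuleCat.ofHom
    { toFun := inclusionₗ k 𝔳 𝔴
      map_add' := map_add _
      map_smul' := fun a x => LinearMap.congr_fun (inclusionₗ_rep k h a) x })

end Str

end Modules

end StringAlgebra

/-!
Fix a recursive term `τ = τ(v,j)` with value `𝔵 = ⟨μ, τ₁ τ τ₂⟩(1_{(v,j)})`, and let `W` be the common
limit of the iterates of `τ₁ τ τ₂` on `1_{(v,j)}` and of the iterates of `μ` on `𝔵`.  Let
`s_0 = 1_{(v,j)}, s_1, s_2, …` be the former iterates.  Values of `l`-terms continue a string by an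
inverse syllable, values of `l̄`-terms by a direct one (`LTermVal.follows`, `LbarTermVal.follows`).
Hence `W` begins with an inverse syllable, whereas `𝔵` is followed by a direct one in `W`.  If `𝔵𝔳`
is a string, this implies that `𝔲𝔳` is a string for all initial parts `𝔲` of `W`
(`Str.exists_isConcat`).  So the inclusion `M(𝔳) → M(𝔵𝔳)` is, for all large `N`, the composition of
the inclusions
`M(𝔳) = M(s_0 𝔳) → M(s_1 𝔳) → ⋯ → M(s_N 𝔳)`
and of the projection from `M(s_N 𝔳)` to its factor module `M(𝔵𝔳)`, and each of the `N` inclusions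
passes through an inclusion that carries the label `τ(v,j)` itself, since `τ` is a factor of
`τ₁ τ τ₂`.  Consequently, if all inclusions with this label lie in an ideal, then they lie in all its
finite powers (`IsRecursive.powIdeal_mem`), and a transfinite induction puts them into all powers of
the radical (`IsRecursive.ordPow_mem`).

The induction starts with the fact that these inclusions are non-invertible maps between
indecomposable modules.  To see that a string module `M(𝔲)` is indecomposable
(`Str.isIndec_stringModule`), consider the matrix of an endomorphism `φ` with respect to the basis
`z_0, …, z_n`.  Its diagonal entries all agree.  If `z_i` occurs in `φ(z_j)`, then the two half words
of `𝔲` that start at the position `i` dominate those that start at `j`, in the lexicographic order in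
which direct syllables come before the end of a word, and inverse ones after it
(`Str.IsSupport.exists_dominates`).  Since `𝔲` is not its own inverse, the half words at different
positions are different, and so the matrix is triangular, with constant diagonal, for a suitable
order of the basis.  An idempotent of this kind is `0` or `1`.
-/

namespace StringAlgebra

variable {V E : Type v} {A : StringAlgebra V E}

namespace Str

/-! ### The action of the arrows on the basis of a string module -/

theorem getElem?_succ_ne_inverse (𝔲 : A.Str) {i : ℕ} {α β : Syl E} (h : 𝔲.syls[i]? = some α)
    (h' : 𝔲.syls[i + 1]? = some β) : β ≠ α.inverse := by
  obtain ⟨hi, rfl⟩ := List.getElem?_eq_some_iff.1 h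
  obtain ⟨hi', rfl⟩ := List.getElem?_eq_some_iff.1 h'
  exact ((List.isChain_iff_getElem.1 𝔲.chain_ok) i hi').2

/-- The arrow `b` maps the basis vector `z_i` of `M(𝔲)` to `z_{i'}`. -/
def ArrStep (𝔲 : A.Str) (b : E) (i i' : ℕ) : Prop :=
  (i' = i + 1 ∧ 𝔲.syls[i]? = some (.dir b)) ∨ (i = i' + 1 ∧ 𝔲.syls[i']? = some (.inv b))

theorem ArrStep.lt_left {𝔲 : A.Str} {b : E} {i i' : ℕ} (h : 𝔲.ArrStep b i i') :
    i < 𝔲.len + 1 := by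
  unfold len
  rcases h with ⟨_, h⟩ | ⟨_, h⟩ <;> have := (List.getElem?_eq_some_iff.1 h).1 <;> omega

theorem ArrStep.lt_right {𝔲 : A.Str} {b : E} {i i' : ℕ} (h : 𝔲.ArrStep b i i') :
    i' < 𝔲.len + 1 := by
  unfold len
  rcases h with ⟨_, h⟩ | ⟨_, h⟩ <;> have := (List.getElem?_eq_some_iff.1 h).1 <;> omega

theorem ArrStep.right_unique {𝔲 : A.Str} {b : E} {i j j' : ℕ} (h : 𝔲.ArrStep b i j)
    (h' : 𝔲.ArrStep b i j') : j = j' := by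
  rcases h with ⟨rfl, h⟩ | ⟨h1, h⟩ <;> rcases h' with ⟨rfl, h'⟩ | ⟨h2, h'⟩
  · rfl
  · subst h2; exact absurd rfl (𝔲.getElem?_succ_ne_inverse h' h)
  · subst h1; exact absurd rfl (𝔲.getElem?_succ_ne_inverse h h')
  · omega

theorem ArrStep.left_unique {𝔲 : A.Str} {b : E} {i i' j : ℕ} (h : 𝔲.ArrStep b i j)
    (h' : 𝔲.ArrStep b i' j) : i = i' := by
  rcases h with ⟨h1, h⟩ | ⟨h1, h⟩ <;> rcases h' with ⟨h2, h'⟩ | ⟨h2, h'⟩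
  · omega
  · subst h1; exact absurd rfl (𝔲.getElem?_succ_ne_inverse h h')
  · subst h2; exact absurd rfl (𝔲.getElem?_succ_ne_inverse h' h)
  · omega

section Coefficients

variable (k : Type u) [Field k]

theorem genAct_of_arrStep {𝔲 : A.Str} {b : E} {i i' : ℕ} (h : 𝔲.ArrStep b i i') :
    𝔲.genAct k (.inr b) (𝔲.z k i) = 𝔲.z k i' := by
  classical
  rw [genAct_inr_z]
  have hu := fun j (hj : 𝔲.ArrStep b i j) => h.right_unique hj
  rcases h with ⟨rfl, h⟩ | ⟨rfl, h⟩
  · rw [if_pos h, if_neg, add_zero]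
    rintro ⟨h0, h1⟩
    have := hu (i - 1) (Or.inr ⟨by omega, h1⟩)
    omega
  · rw [if_neg, if_pos ⟨by omega, by simpa using h⟩, zero_add, Nat.add_sub_cancel]
    intro h1
    have := hu (i' + 1 + 1) (Or.inl ⟨rfl, h1⟩)
    omega

theorem genAct_of_not_arrStep {𝔲 : A.Str} {b : E} {i : ℕ} (h : ∀ i', ¬ 𝔲.ArrStep b i i') :
    𝔲.genAct k (.inr b) (𝔲.z k i) = 0 := by
  classical
  rw [genAct_inr_z, if_neg, if_neg, add_zero]
  · rintro ⟨h0, h1⟩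
    exact h (i - 1) (Or.inr ⟨by omega, h1⟩)
  · exact fun h1 => h (i + 1) (Or.inl ⟨rfl, h1⟩)

/-- The coordinate function of `M(𝔲)` that belongs to `z_i` (zero if `i` is out of range). -/
noncomputable def coeff (𝔲 : A.Str) (i : ℕ) : 𝔲.Mod k →ₗ[k] k :=
  (𝔲.stdBasis k).constr k fun m => if (m : ℕ) = i then 1 else 0

theorem coeff_z (𝔲 : A.Str) (i : ℕ) {j : ℕ} (hj : j < 𝔲.len + 1) :
    𝔲.coeff k i (𝔲.z k j) = if j = i then 1 else 0 := by
  rw [z_of_lt k 𝔲 hj, coeff, Module.Basis.constr_basis]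

theorem sum_coeff_z (𝔲 : A.Str) (x : 𝔲.Mod k) :
    x = ∑ l ∈ Finset.range (𝔲.len + 1), 𝔲.coeff k l x • 𝔲.z k l := by
  have : LinearMap.id =
      ∑ l ∈ Finset.range (𝔲.len + 1), (𝔲.coeff k l).smulRight (𝔲.z k l) := by
    refine end_ext k fun m => ?_
    by_cases hm : m < 𝔲.len + 1
    · simp [LinearMap.sum_apply, coeff_z k 𝔲 _ hm, hm, ite_smul]
    · simp [z, hm]
  have h := LinearMap.congr_fun this x
  simpa [LinearMap.sum_apply] using h

theorem coeff_genAct_of_arrStep {𝔲 : A.Str} {b : E} {i i' : ℕ} (h : 𝔲.ArrStep b i i')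
    (x : 𝔲.Mod k) : 𝔲.coeff k i' (𝔲.genAct k (.inr b) x) = 𝔲.coeff k i x := by
  suffices 𝔲.coeff k i' ∘ₗ 𝔲.genAct k (.inr b) = 𝔲.coeff k i from LinearMap.congr_fun this x
  refine end_ext k fun m => ?_
  rw [LinearMap.comp_apply]
  by_cases hm : m < 𝔲.len + 1
  swap
  · simp [z, hm]
  rw [coeff_z k 𝔲 _ hm]
  by_cases hs : ∃ m', 𝔲.ArrStep b m m'
  · obtain ⟨m', hs⟩ := hs
    rw [genAct_of_arrStep k hs, coeff_z k 𝔲 _ hs.lt_right]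
    refine if_congr ⟨?_, ?_⟩ rfl rfl
    · rintro rfl; exact hs.left_unique h
    · rintro rfl; exact hs.right_unique h
  · push Not at hs
    rw [genAct_of_not_arrStep k hs, map_zero, if_neg]
    rintro rfl; exact hs _ h

theorem coeff_genAct_of_not_arrStep {𝔲 : A.Str} {b : E} {i' : ℕ} (h : ∀ i, ¬ 𝔲.ArrStep b i i')
    (x : 𝔲.Mod k) : 𝔲.coeff k i' (𝔲.genAct k (.inr b) x) = 0 := by
  suffices 𝔲.coeff k i' ∘ₗ 𝔲.genAct k (.inr b) = 0 from LinearMap.congr_fun this x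
  refine end_ext k fun m => ?_
  rw [LinearMap.comp_apply, LinearMap.zero_apply]
  by_cases hs : ∃ m', 𝔲.ArrStep b m m'
  · obtain ⟨m', hs⟩ := hs
    rw [genAct_of_arrStep k hs, coeff_z k 𝔲 _ hs.lt_right, if_neg]
    rintro rfl; exact h _ hs
  · push Not at hs
    rw [genAct_of_not_arrStep k hs, map_zero]

end Coefficients

/-! ### Half words -/

/-- The two half words of a string `𝔲` at the position `i`: the syllables after `i` for `true`,
and the inverses of the syllables before `i`, read backwards, for `false`. -/
def half (𝔲 : A.Str) (i : ℕ) : Bool → List (Syl E)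
  | true => 𝔲.syls.drop i
  | false => (𝔲.syls.take i).reverse.map Syl.inverse

theorem _root_.Syl.inverse_inverse (α : Syl E) : α.inverse.inverse = α := by cases α <;> rfl

theorem half_step_true (𝔲 : A.Str) {i : ℕ} {α : Syl E} (h : 𝔲.syls[i]? = some α) :
    𝔲.half i true = α :: 𝔲.half (i + 1) true ∧
      𝔲.half (i + 1) false = α.inverse :: 𝔲.half i false := by
  obtain ⟨hi, rfl⟩ := List.getElem?_eq_some_iff.1 h
  refine ⟨List.drop_eq_getElem_cons hi, ?_⟩
  rw [half, half, List.take_succ_eq_append_getElem hi, List.reverse_append, List.map_append]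
  rfl

theorem ArrStep.half_eq {𝔲 : A.Str} {b : E} {i i' : ℕ} (h : 𝔲.ArrStep b i i') :
    ∃ d, 𝔲.half i d = .dir b :: 𝔲.half i' d ∧ 𝔲.half i' (!d) = .inv b :: 𝔲.half i (!d) := by
  rcases h with ⟨rfl, h⟩ | ⟨rfl, h⟩
  · exact ⟨true, 𝔲.half_step_true h⟩
  · exact ⟨false, (𝔲.half_step_true h).2, (𝔲.half_step_true h).1⟩

/-- Removing the first syllable `α` of a half word amounts to moving the position by one step; the
opposite half word grows by `α⁻¹`. -/
theorem exists_step_of_half_eq_cons (𝔲 : A.Str) {i : ℕ} {d : Bool} {α : Syl E} {t : List (Syl E)}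
    (hi : i < 𝔲.len + 1) (h : 𝔲.half i d = α :: t) :
    ∃ i', t = 𝔲.half i' d ∧ 𝔲.half i' (!d) = α.inverse :: 𝔲.half i (!d) ∧
      (∀ b, α = .dir b → 𝔲.ArrStep b i i') ∧ (∀ b, α = .inv b → 𝔲.ArrStep b i' i) := by
  cases d with
  | true =>
    have hget : 𝔲.syls[i]? = some α := by
      have : (𝔲.syls.drop i)[0]? = some α := by
        rw [show 𝔲.syls.drop i = _ from h]; rfl
      simpa using this
    have hs := 𝔲.half_step_true hget
    refine ⟨i + 1, ?_, hs.2, ?_, ?_⟩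
    · rw [h] at hs; exact (List.cons.inj hs.1).2
    · rintro b rfl; exact Or.inl ⟨rfl, hget⟩
    · rintro b rfl; exact Or.inr ⟨rfl, hget⟩
  | false =>
    obtain ⟨n, rfl⟩ : ∃ n, i = n + 1 := by
      cases i with
      | zero => simp [half] at h
      | succ n => exact ⟨n, rfl⟩
    have hn : n < 𝔲.syls.length := by unfold len at hi; omega
    have hs := 𝔲.half_step_true (List.getElem?_eq_getElem hn)
    have hc := List.cons.inj (h.symm.trans hs.2)
    have hget : 𝔲.syls[n]? = some α.inverse := by
      rw [hc.1, Syl.inverse_inverse, List.getElem?_eq_getElem hn]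
    refine ⟨n, hc.2, ?_, ?_, ?_⟩
    · rw [hc.1, Syl.inverse_inverse]; exact hs.1
    · rintro b rfl; exact Or.inr ⟨rfl, hget⟩
    · rintro b rfl; exact Or.inl ⟨rfl, hget⟩

/-- The two half words at a position do not begin with the same syllable. -/
theorem half_head_ne (𝔲 : A.Str) {i : ℕ} {d : Bool} {α : Syl E} {t t' : List (Syl E)}
    (hi : i < 𝔲.len + 1) (h : 𝔲.half i d = α :: t) (h' : 𝔲.half i (!d) = α :: t') : False := by
  obtain ⟨i₁, ht, -, hd, hv⟩ := 𝔲.exists_step_of_half_eq_cons hi h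
  obtain ⟨i₂, -, ht', hd', hv'⟩ := 𝔲.exists_step_of_half_eq_cons hi h'
  have e : i₁ = i₂ := by
    cases α with
    | dir b => exact (hd b rfl).right_unique (hd' b rfl)
    | inv b => exact (hv b rfl).left_unique (hv' b rfl)
  subst e
  -- One step in the direction `d` would both shorten and lengthen the half word.
  rw [Bool.not_not, h, ht] at ht'
  have := congrArg List.length ht'
  simp at this
  omega

/-! ### The lexicographic order of half words -/

/-- A rational weight that realises the lexicographic order of words in which a direct syllable
comes before the end of a word, and the end of a word before an inverse syllable. -/
def _root_.Syl.weight : List (Syl E) → ℚ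
  | [] => 0
  | .dir _ :: t => -1 + Syl.weight t / 3
  | .inv _ :: t => 1 + Syl.weight t / 3

open Syl (weight)

theorem _root_.Syl.abs_weight_lt : ∀ x : List (Syl E), |weight x| < 3 / 2
  | [] => by norm_num [weight]
  | .dir _ :: t => by
    have := abs_lt.1 (Syl.abs_weight_lt t)
    rw [weight, abs_lt]; constructor <;> linarith
  | .inv _ :: t => by
    have := abs_lt.1 (Syl.abs_weight_lt t)
    rw [weight, abs_lt]; constructor <;> linarith

/-- The word `x` is at least `y` in the lexicographic order. -/
def _root_.Syl.Dominates (x y : List (Syl E)) : Prop := x = y ∨ weight y < weight x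

open Syl (Dominates)

theorem _root_.Syl.Dominates.cons {x y : List (Syl E)} (α : Syl E) (h : Dominates x y) :
    Dominates (α :: x) (α :: y) := by
  rcases h with rfl | h
  · exact Or.inl rfl
  · right; cases α <;> simp only [weight] <;> linarith

theorem _root_.Syl.dominates_of_head {x y : List (Syl E)} (hx : ∀ b t, x ≠ .dir b :: t)
    (hy : ∀ b t, y ≠ .inv b :: t) : Dominates x y := by
  have hx' : x = [] ∨ 0 < weight x := by
    rcases x with _ | ⟨b | b, t⟩
    · exact Or.inl rfl
    · exact absurd rfl (hx b t)
    · right; have := abs_lt.1 (Syl.abs_weight_lt t); rw [weight]; linarith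
  have hy' : y = [] ∨ weight y < 0 := by
    rcases y with _ | ⟨b | b, t⟩
    · exact Or.inl rfl
    · right; have := abs_lt.1 (Syl.abs_weight_lt t); rw [weight]; linarith
    · exact absurd rfl (hy b t)
  rcases hx' with rfl | hx' <;> rcases hy' with rfl | hy'
  · exact Or.inl rfl
  · right; simpa [weight] using hy'
  · right; simpa [weight] using hx'
  · right; linarith

/-! ### Supports of endomorphisms -/

/-- A relation between positions of a string with the properties of the support
`{(i, j) | z_i occurs in φ(z_j)}` of an endomorphism `φ` of the string module. -/
structure IsSupport (𝔲 : A.Str) (P : ℕ → ℕ → Prop) : Prop where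
  lt_left : ∀ {i j}, P i j → i < 𝔲.len + 1
  lt_right : ∀ {i j}, P i j → j < 𝔲.len + 1
  forward : ∀ {i j b i'}, P i j → 𝔲.ArrStep b i i' → ∃ j', 𝔲.ArrStep b j j' ∧ P i' j'
  backward : ∀ {i j b j'}, P i j → 𝔲.ArrStep b j' j → ∃ i', 𝔲.ArrStep b i' i ∧ P i' j'

namespace IsSupport

variable {𝔲 : A.Str} {P : ℕ → ℕ → Prop}

theorem exists_half_eq_dir (hP : 𝔲.IsSupport P) {i j : ℕ} (h : P i j) {d : Bool} {b : E}
    {t : List (Syl E)} (hd : 𝔲.half i d = .dir b :: t) : ∃ e t', 𝔲.half j e = .dir b :: t' := by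
  obtain ⟨i', -, -, h1, -⟩ := 𝔲.exists_step_of_half_eq_cons (hP.lt_left h) hd
  obtain ⟨j', hj, -⟩ := hP.forward h (h1 b rfl)
  obtain ⟨e, he, -⟩ := hj.half_eq
  exact ⟨e, _, he⟩

theorem exists_half_eq_inv (hP : 𝔲.IsSupport P) {i j : ℕ} (h : P i j) {e : Bool} {b : E}
    {t : List (Syl E)} (he : 𝔲.half j e = .inv b :: t) : ∃ d t', 𝔲.half i d = .inv b :: t' := by
  obtain ⟨j', -, -, -, h1⟩ := 𝔲.exists_step_of_half_eq_cons (hP.lt_right h) he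
  obtain ⟨i', hi, -⟩ := hP.backward h (h1 b rfl)
  obtain ⟨d, -, hd⟩ := hi.half_eq
  exact ⟨!d, _, hd⟩

/-- A support moves along half words that begin with the same syllable. -/
theorem advance (hP : 𝔲.IsSupport P) {i j : ℕ} (h : P i j) {d e : Bool} {α : Syl E}
    {t t' : List (Syl E)} (hd : 𝔲.half i d = α :: t) (he : 𝔲.half j e = α :: t') :
    ∃ i' j', P i' j' ∧ 𝔲.half i d = α :: 𝔲.half i' d ∧ 𝔲.half j e = α :: 𝔲.half j' e ∧
      𝔲.half i' (!d) = α.inverse :: 𝔲.half i (!d) ∧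
      𝔲.half j' (!e) = α.inverse :: 𝔲.half j (!e) := by
  obtain ⟨i', rfl, hi', h1, h2⟩ := 𝔲.exists_step_of_half_eq_cons (hP.lt_left h) hd
  obtain ⟨j', rfl, hj', h3, h4⟩ := 𝔲.exists_step_of_half_eq_cons (hP.lt_right h) he
  refine ⟨i', j', ?_, hd, he, hi', hj'⟩
  cases α with
  | dir b =>
    obtain ⟨j'', hj, hp⟩ := hP.forward h (h1 b rfl)
    rwa [hj.right_unique (h3 b rfl)] at hp
  | inv b =>
    obtain ⟨i'', hi, hp⟩ := hP.backward h (h4 b rfl)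
    rwa [hi.left_unique (h2 b rfl)] at hp

/-- If the half words opposite to `d` and `e` begin with the same syllable, then the half words in
the directions `d` and `e` are compared: a common first syllable allows to move on to the next
positions, and if there is none, then the half word at `i` does not begin with a direct syllable, nor
the one at `j` with an inverse one. -/
theorem dominates_of_opposite (hP : 𝔲.IsSupport P) {i j : ℕ} (h : P i j) {d e : Bool}
    {α : Syl E} {t t' : List (Syl E)} (hd : 𝔲.half i (!d) = α :: t)
    (he : 𝔲.half j (!e) = α :: t') : Dominates (𝔲.half i d) (𝔲.half j e) := by
  induction hn : (𝔲.half i d).length generalizing i j α t t' with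
  | zero =>
    refine Syl.dominates_of_head (fun b t h' => by simp [h'] at hn) fun b s hs => ?_
    obtain ⟨d', s', hd'⟩ := hP.exists_half_eq_inv h hs
    rcases Bool.eq_or_eq_not d' d with rfl | rfl
    · simp [hd'] at hn
    · obtain rfl := (List.cons.inj (hd.symm.trans hd')).1
      exact 𝔲.half_head_ne (hP.lt_right h) hs he
  | succ n ih =>
    by_cases hc : ∃ β s s', 𝔲.half i d = β :: s ∧ 𝔲.half j e = β :: s'
    · obtain ⟨β, s, s', h1, h2⟩ := hc
      obtain ⟨i', j', hp, hi, hj, hi', hj'⟩ := hP.advance h h1 h2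
      rw [hi, hj]
      refine (ih hp hi' hj' ?_).cons β
      rw [hi] at hn; simpa using hn
    · refine Syl.dominates_of_head (fun b s hs => ?_) fun b s hs => ?_
      · obtain ⟨e', s', he'⟩ := hP.exists_half_eq_dir h hs
        rcases Bool.eq_or_eq_not e' e with rfl | rfl
        · exact hc ⟨_, _, _, hs, he'⟩
        · obtain rfl := (List.cons.inj (he.symm.trans he')).1
          exact 𝔲.half_head_ne (hP.lt_left h) hs hd
      · obtain ⟨d', s', hd'⟩ := hP.exists_half_eq_inv h hs
        rcases Bool.eq_or_eq_not d' d with rfl | rfl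
        · exact hc ⟨_, _, _, hd', hs⟩
        · obtain rfl := (List.cons.inj (hd.symm.trans hd')).1
          exact 𝔲.half_head_ne (hP.lt_right h) hs he

/-- For a suitable matching, given by `e`, the half words at `i` dominate those at `j`. -/
theorem exists_dominates (hP : 𝔲.IsSupport P) {i j : ℕ} (h : P i j) :
    ∃ e, Dominates (𝔲.half i true) (𝔲.half j e) ∧ Dominates (𝔲.half i false) (𝔲.half j !e) := by
  by_cases hc : ∃ d e β s s', 𝔲.half i d = β :: s ∧ 𝔲.half j e = β :: s'
  · obtain ⟨d, e, β, s, s', h1, h2⟩ := hc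
    have hopp : Dominates (𝔲.half i !d) (𝔲.half j !e) :=
      hP.dominates_of_opposite h (by rwa [Bool.not_not]) (by rwa [Bool.not_not])
    have hsame : Dominates (𝔲.half i d) (𝔲.half j e) := by
      obtain ⟨i', j', hp, hi, hj, hi', hj'⟩ := hP.advance h h1 h2
      rw [hi, hj]
      exact (hP.dominates_of_opposite hp hi' hj').cons β
    cases d with
    | true => exact ⟨e, hsame, hopp⟩
    | false => exact ⟨!e, hopp, by rwa [Bool.not_not]⟩
  · have key : ∀ d e, Dominates (𝔲.half i d) (𝔲.half j e) := by
      refine fun d e => Syl.dominates_of_head (fun b s hs => ?_) fun b s hs => ?_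
      · obtain ⟨e', s', he'⟩ := hP.exists_half_eq_dir h hs
        exact hc ⟨_, _, _, _, _, hs, he'⟩
      · obtain ⟨d', s', hd'⟩ := hP.exists_half_eq_inv h hs
        exact hc ⟨_, _, _, _, _, hd', hs⟩
    exact ⟨true, key _ _, key _ _⟩

end IsSupport

/-! ### The potential of a position -/

/-- A string of positive length is not its own formal inverse: its middle syllable, or the two
syllables in its middle, would be inverse to themselves, or to each other. -/
theorem eq_nil_of_reverse_eq (𝔲 : A.Str) (h : 𝔲.syls.reverse.map Syl.inverse = 𝔲.syls) :
    𝔲.syls = [] := by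
  by_contra hne
  have hpos := List.length_pos_iff.2 hne
  have key : ∀ m n, m + n + 1 = 𝔲.syls.length → ∀ α, 𝔲.syls[m]? = some α →
      𝔲.syls[n]? = some α.inverse := by
    intro m n hmn α hα
    rw [← h, List.getElem?_map, List.getElem?_reverse (by omega),
      show 𝔲.syls.length - 1 - n = m by omega, hα]
    rfl
  rcases Nat.even_or_odd' 𝔲.syls.length with ⟨m, hm | hm⟩
  · obtain ⟨l, rfl⟩ : ∃ l, m = l + 1 := ⟨m - 1, by omega⟩
    have hl : 𝔲.syls[l]? = some 𝔲.syls[l] := List.getElem?_eq_getElem (by omega)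
    exact 𝔲.getElem?_succ_ne_inverse hl (key l (l + 1) (by omega) _ hl) rfl
  · have hl : 𝔲.syls[m]? = some 𝔲.syls[m] := List.getElem?_eq_getElem (by omega)
    have := hl.symm.trans (key m m (by omega) _ hl)
    cases hs : 𝔲.syls[m] <;> simp [hs, Syl.inverse] at this

/-- The sum of the weights of the two half words at a position. -/
def potential (𝔲 : A.Str) (i : ℕ) : ℚ := weight (𝔲.half i true) + weight (𝔲.half i false)

theorem eq_of_half_eq (𝔲 : A.Str) {i j : ℕ} (hi : i < 𝔲.len + 1) (hj : j < 𝔲.len + 1) (e : Bool)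
    (h : 𝔲.half i true = 𝔲.half j e) (h' : 𝔲.half i false = 𝔲.half j !e) : i = j := by
  unfold len at hi hj
  have hl := congrArg List.length h
  have hl' := congrArg List.length h'
  cases e with
  | true => simp [half] at hl; omega
  | false =>
    have hn : 𝔲.syls = [] := by
      refine 𝔲.eq_nil_of_reverse_eq ?_
      simp only [half, Bool.not_false] at h h'
      conv_lhs =>
        rw [← List.take_append_drop j 𝔲.syls, List.reverse_append, List.map_append, ← h, ← h']
      have hinv : Syl.inverse ∘ Syl.inverse = (id : Syl E → Syl E) :=
        funext Syl.inverse_inverse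
      rw [← List.map_reverse, List.reverse_reverse, List.map_map, hinv, List.map_id,
        List.take_append_drop]
    simp [hn] at hi hj; omega

/-- The endomorphisms of a string module are triangular with respect to the potential. -/
theorem IsSupport.potential_lt {𝔲 : A.Str} {P : ℕ → ℕ → Prop} (hP : 𝔲.IsSupport P) {i j : ℕ}
    (h : P i j) (hne : i ≠ j) : 𝔲.potential j < 𝔲.potential i := by
  obtain ⟨e, h1, h2⟩ := hP.exists_dominates h
  have hj : 𝔲.potential j = weight (𝔲.half j e) + weight (𝔲.half j !e) := by
    cases e
    · exact add_comm _ _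
    · rfl
  rw [hj, potential]
  rcases h1 with h1 | h1 <;> rcases h2 with h2 | h2
  · exact absurd (𝔲.eq_of_half_eq (hP.lt_left h) (hP.lt_right h) e h1 h2) hne
  · rw [h1]; linarith
  · rw [h2]; linarith
  · linarith

/-! ### String modules are indecomposable -/

section Indecomposable

variable (k : Type u) [Field k]

variable {k} in
theorem isSupport_of_forall_comm {𝔲 : A.Str} {φ : 𝔲.Mod k →ₗ[k] 𝔲.Mod k}
    (hφ : ∀ b x, φ (𝔲.genAct k (.inr b) x) = 𝔲.genAct k (.inr b) (φ x)) :
    𝔲.IsSupport fun i j => 𝔲.coeff k i (φ (𝔲.z k j)) ≠ 0 where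
  lt_left {i j} h := by
    by_contra hi
    refine h ?_
    rw [sum_coeff_z k 𝔲 (φ (𝔲.z k j)), map_sum]
    refine Finset.sum_eq_zero fun l hl => ?_
    rw [map_smul, coeff_z k 𝔲 i (Finset.mem_range.1 hl), if_neg, smul_zero]
    rintro rfl; exact hi (Finset.mem_range.1 hl)
  lt_right {i j} h := by
    by_contra hj
    exact h (by simp [z, hj])
  forward {i j b i'} h hs := by
    rw [← coeff_genAct_of_arrStep k hs, ← hφ] at h
    by_cases hj : ∃ j', 𝔲.ArrStep b j j'
    · obtain ⟨j', hj⟩ := hj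
      rw [genAct_of_arrStep k hj] at h
      exact ⟨j', hj, h⟩
    · push Not at hj
      rw [genAct_of_not_arrStep k hj, map_zero, map_zero] at h
      exact absurd rfl h
  backward {i j b j'} h hs := by
    rw [← genAct_of_arrStep k hs, hφ] at h
    by_cases hi : ∃ i', 𝔲.ArrStep b i' i
    · obtain ⟨i', hi⟩ := hi
      rw [coeff_genAct_of_arrStep k hi] at h
      exact ⟨i', hi, h⟩
    · push Not at hi
      exact absurd (coeff_genAct_of_not_arrStep k hi _) h

variable {k} in
/-- The diagonal coefficients of an endomorphism of a string module are all equal. -/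
theorem coeff_diag_eq {𝔲 : A.Str} {φ : 𝔲.Mod k →ₗ[k] 𝔲.Mod k}
    (hφ : ∀ b x, φ (𝔲.genAct k (.inr b) x) = 𝔲.genAct k (.inr b) (φ x)) {i : ℕ}
    (hi : i < 𝔲.len + 1) : 𝔲.coeff k i (φ (𝔲.z k i)) = 𝔲.coeff k 0 (φ (𝔲.z k 0)) := by
  have key : ∀ b i i', 𝔲.ArrStep b i i' →
      𝔲.coeff k i' (φ (𝔲.z k i')) = 𝔲.coeff k i (φ (𝔲.z k i)) := by
    intro b i i' h
    rw [← genAct_of_arrStep k h, hφ, coeff_genAct_of_arrStep k h]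
  induction i with
  | zero => rfl
  | succ i ih =>
    rw [← ih (by omega)]
    have hi' : i < 𝔲.syls.length := by unfold len at hi; omega
    have hget := List.getElem?_eq_getElem hi'
    cases hs : 𝔲.syls[i] with
    | dir b => exact key b _ _ (Or.inl ⟨rfl, by rw [hget, hs]⟩)
    | inv b => exact (key b _ _ (Or.inr ⟨rfl, by rw [hget, hs]⟩)).symm

variable {k} in
theorem coeff_comp {𝔲 : A.Str} (φ : 𝔲.Mod k →ₗ[k] 𝔲.Mod k) (i : ℕ) (x : 𝔲.Mod k) :
    𝔲.coeff k i (φ x) =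
      ∑ l ∈ Finset.range (𝔲.len + 1), 𝔲.coeff k l x * 𝔲.coeff k i (φ (𝔲.z k l)) := by
  conv_lhs => rw [sum_coeff_z k 𝔲 x, map_sum, map_sum]
  simp

variable {k} in
theorem coeff_diag_idem {𝔲 : A.Str} {φ : 𝔲.Mod k →ₗ[k] 𝔲.Mod k}
    (hφ : ∀ b x, φ (𝔲.genAct k (.inr b) x) = 𝔲.genAct k (.inr b) (φ x))
    (hid : ∀ x, φ (φ x) = φ x) :
    𝔲.coeff k 0 (φ (𝔲.z k 0)) = 0 ∨ 𝔲.coeff k 0 (φ (𝔲.z k 0)) = 1 := by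
  have h := coeff_comp φ 0 (φ (𝔲.z k 0))
  rw [hid, Finset.sum_eq_single 0] at h
  · have h2 : 𝔲.coeff k 0 (φ (𝔲.z k 0)) * (𝔲.coeff k 0 (φ (𝔲.z k 0)) - 1) = 0 := by
      linear_combination -h
    rcases mul_eq_zero.1 h2 with h2 | h2
    · exact Or.inl h2
    · exact Or.inr (sub_eq_zero.1 h2)
  · intro l _ hl
    by_contra hne
    have h1 := (isSupport_of_forall_comm hφ).potential_lt (left_ne_zero_of_mul hne) hl
    have h2 := (isSupport_of_forall_comm hφ).potential_lt (right_ne_zero_of_mul hne) hl.symm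
    exact lt_asymm h1 h2
  · simp

variable {k} in
/-- An idempotent endomorphism with zero diagonal vanishes: it would factor every non-zero
coefficient `(i, j)` through coefficients `(i, l)` and `(l, j)` with smaller differences of
potentials. -/
theorem eq_zero_of_diag_eq_zero {𝔲 : A.Str} {φ : 𝔲.Mod k →ₗ[k] 𝔲.Mod k}
    (hφ : ∀ b x, φ (𝔲.genAct k (.inr b) x) = 𝔲.genAct k (.inr b) (φ x))
    (hid : ∀ x, φ (φ x) = φ x) (h0 : 𝔲.coeff k 0 (φ (𝔲.z k 0)) = 0) : φ = 0 := by
  classical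
  have hS := isSupport_of_forall_comm hφ
  have hdiag : ∀ i, 𝔲.coeff k i (φ (𝔲.z k i)) = 0 := fun i => by
    by_cases hi : i < 𝔲.len + 1
    · rw [coeff_diag_eq hφ hi, h0]
    · simp [z, hi]
  have hall : ∀ i j, 𝔲.coeff k i (φ (𝔲.z k j)) = 0 := by
    by_contra hex
    push Not at hex
    obtain ⟨i₀, j₀, h₀⟩ := hex
    let s := (Finset.range (𝔲.len + 1) ×ˢ Finset.range (𝔲.len + 1)).filter
      fun p => 𝔲.coeff k p.1 (φ (𝔲.z k p.2)) ≠ 0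
    have hmem : ∀ i j, 𝔲.coeff k i (φ (𝔲.z k j)) ≠ 0 → (i, j) ∈ s := fun i j h =>
      Finset.mem_filter.2 ⟨Finset.mem_product.2 ⟨Finset.mem_range.2 (hS.lt_left h),
        Finset.mem_range.2 (hS.lt_right h)⟩, h⟩
    obtain ⟨⟨i, j⟩, hij, hmin⟩ := s.exists_min_image
      (fun p => 𝔲.potential p.1 - 𝔲.potential p.2) ⟨_, hmem _ _ h₀⟩
    have hne : 𝔲.coeff k i (φ (𝔲.z k j)) ≠ 0 := (Finset.mem_filter.1 hij).2
    have h := hne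
    rw [← hid, coeff_comp φ i] at h
    obtain ⟨l, -, hl⟩ := Finset.exists_ne_zero_of_sum_ne_zero h
    have hlj := left_ne_zero_of_mul hl
    have h1 := hmin (i, l) (hmem _ _ (right_ne_zero_of_mul hl))
    have h2 : 𝔲.potential j < 𝔲.potential l := hS.potential_lt hlj <| by
      rintro rfl; exact hlj (hdiag _)
    simp only at h1
    linarith
  refine end_ext k fun j => ?_
  rw [sum_coeff_z k 𝔲 (φ (𝔲.z k j))]
  simp [hall]

variable [Fintype V]

theorem rep_gen (𝔲 : A.Str) (g : V ⊕ E) :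
    𝔲.rep k (RingQuot.mkAlgHom k (A.AlgRel k) (FreeAlgebra.ι k g)) = 𝔲.genAct k g := by
  rw [rep, RingQuot.liftAlgHom_mkAlgHom_apply, FreeAlgebra.lift_ι_apply]

theorem smul_algebraMap (𝔲 : A.Str) (c : k) (x : 𝔲.Mod k) :
    algebraMap k (A.Alg k) c • x = c • x := by
  rw [smul_def, AlgHom.commutes]; rfl

theorem isIndec_stringModule (𝔲 : A.Str) : IsIndec (𝔲.stringModule k) := by
  refine ⟨?_, fun P Q hPQ => ?_⟩
  · have : Nontrivial (𝔲.Mod k) := (𝔲.stdBasis k).repr.toEquiv.nontrivial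
    exact this
  change Submodule (A.Alg k) (𝔲.Mod k) at P Q
  -- The projection onto one summand along the other one, as a `k`-linear map.
  have main : ∀ (P Q : Submodule (A.Alg k) (𝔲.Mod k)) (hPQ : IsCompl P Q),
      ∃ φ : 𝔲.Mod k →ₗ[k] 𝔲.Mod k,
      (∀ b x, φ (𝔲.genAct k (.inr b) x) = 𝔲.genAct k (.inr b) (φ x)) ∧ (∀ x, φ (φ x) = φ x) ∧
      (∀ x ∈ P, φ x = x) ∧ (∀ x ∈ Q, φ x = 0) := by
    intro P Q hPQ
    let π : 𝔲.Mod k →ₗ[A.Alg k] 𝔲.Mod k := P.subtype ∘ₗ P.projectionOnto Q hPQ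
    refine ⟨{ toFun := π, map_add' := map_add π, map_smul' := fun c x => ?_ }, ?_, ?_, ?_, ?_⟩
    · rw [← smul_algebraMap, map_smul, smul_algebraMap]; rfl
    · intro b x
      rw [← rep_gen, ← smul_def, ← smul_def]
      exact map_smul π _ x
    · intro x
      simp [π]
    · intro x hx
      simpa [π] using congrArg Subtype.val (Submodule.projectionOnto_apply_left hPQ ⟨x, hx⟩)
    · intro x hx
      simpa [π] using hx
  obtain ⟨φ, hφ, hid, hP, hQ⟩ := main P Q hPQ
  rcases coeff_diag_idem hφ hid with h | h
  · left
    have := eq_zero_of_diag_eq_zero hφ hid h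
    refine (Submodule.eq_bot_iff _).2 fun x hx => ?_
    rw [← hP x hx, this]; rfl
  · right
    obtain ⟨ψ, hψ⟩ : ∃ ψ : 𝔲.Mod k →ₗ[k] 𝔲.Mod k, ∀ x, ψ x = x - φ x :=
      ⟨LinearMap.id - φ, fun _ => rfl⟩
    have h1 : 𝔲.coeff k 0 (ψ (𝔲.z k 0)) = 0 := by
      rw [hψ, map_sub, h, coeff_z k 𝔲 0 (by omega), if_pos rfl, sub_self]
    have := eq_zero_of_diag_eq_zero (fun b x => by rw [hψ, hψ, hφ, map_sub])
      (fun x => by rw [hψ, hψ, map_sub, hid, sub_self, sub_zero]) h1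
    refine (Submodule.eq_bot_iff _).2 fun x hx => ?_
    have h2 := hψ x
    rw [hQ x hx, sub_zero, this] at h2
    exact h2.symm

end Indecomposable

end Str
end StringAlgebra

/-! ### Infixes that avoid a letter -/

theorem List.infix_or_infix_of_notMem {α : Type*} {l P Q : List α} {a : α}
    (h : l <:+: P ++ a :: Q) (ha : a ∉ l) : l <:+: P ∨ l <:+: Q := by
  have hp : ∀ l' : List α, l' <+: a :: Q → a ∉ l' → l' = [] := by
    intro l' h' ha'
    rcases List.prefix_cons_iff.1 h' with h' | ⟨t, rfl, -⟩
    · exact h'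
    · exact absurd List.mem_cons_self ha'
  rcases List.infix_append_iff.1 h with h | h | ⟨l₁, l₂, rfl, h₁, h₂⟩
  · exact Or.inl h
  · rcases List.infix_cons_iff.1 h with h | h
    · rw [hp l h ha]; exact Or.inl (List.nil_infix)
    · exact Or.inr h
  · rw [hp l₂ h₂ fun h => ha (List.mem_append_right _ h), List.append_nil]
    exact Or.inl h₁.isInfix

namespace StringAlgebra

variable {V E : Type v} {A : StringAlgebra V E}

namespace Str

/-! ### Initial substrings followed by a prescribed kind of syllable -/

theorem IsInitial.len_le {𝔳 𝔴 : A.Str} (h : 𝔳.IsInitial 𝔴) : 𝔳.len ≤ 𝔴.len := h.2.2.length_le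

theorem IsInitial.eq_of_len_le {𝔳 𝔴 : A.Str} (h : 𝔳.IsInitial 𝔴) (hl : 𝔴.len ≤ 𝔳.len) :
    𝔳 = 𝔴 :=
  Str.ext h.1 h.2.1 (h.2.2.eq_of_length_le hl)

theorem IsInitial.trans {𝔲 𝔳 𝔴 : A.Str} (h : 𝔲.IsInitial 𝔳) (h' : 𝔳.IsInitial 𝔴) :
    𝔲.IsInitial 𝔴 :=
  ⟨h.1.trans h'.1, h.2.1.trans h'.2.1, h.2.2.trans h'.2.2⟩

/-- `𝔳` is an initial substring of `𝔴`, followed in `𝔴` by nothing or by a syllable in the range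
of `c`. For `c = Syl.inv` it is thus an image substring, for `c = Syl.dir` a factor substring. -/
def Follows (c : E → Syl E) (𝔳 𝔴 : A.Str) : Prop :=
  𝔳.IsInitial 𝔴 ∧ ∀ α ∈ 𝔴.syls[𝔳.len]?, ∃ b, α = c b

theorem Follows.refl (c : E → Syl E) (𝔳 : A.Str) : 𝔳.Follows c 𝔳 := by
  refine ⟨⟨rfl, rfl, List.prefix_rfl⟩, fun α hα => ?_⟩
  rw [List.getElem?_eq_none (by unfold len; omega)] at hα
  simp at hα

theorem Follows.trans {c : E → Syl E} {𝔲 𝔳 𝔴 : A.Str} (h : 𝔲.Follows c 𝔳)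
    (h' : 𝔳.Follows c 𝔴) : 𝔲.Follows c 𝔴 := by
  refine ⟨h.1.trans h'.1, fun α hα => ?_⟩
  rcases Nat.lt_or_ge 𝔲.len 𝔳.len with hl | hl
  · rw [h'.1.getElem? hl] at hα
    exact h.2 α hα
  · obtain rfl := h.1.eq_of_len_le hl
    exact h'.2 α hα

/-- The string `𝔲` is an initial part of the `ℕ`-string `W`. -/
def Agrees (W : ℕ → Syl E) (𝔲 : A.Str) : Prop := ∀ i, ∀ α ∈ 𝔲.syls[i]?, W i = α

theorem Agrees.of_isInitial {W : ℕ → Syl E} {𝔳 𝔴 : A.Str} (h : 𝔴.Agrees W) (hi : 𝔳.IsInitial 𝔴) :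
    𝔳.Agrees W := by
  intro i α hα
  refine h i α ?_
  obtain ⟨hlt, -⟩ := List.getElem?_eq_some_iff.1 (Option.mem_def.1 hα)
  rwa [hi.getElem? hlt]

theorem Agrees.prefix {W : ℕ → Syl E} {𝔳 𝔴 : A.Str} (h : 𝔳.Agrees W) (h' : 𝔴.Agrees W)
    (hl : 𝔳.len ≤ 𝔴.len) : 𝔳.syls <+: 𝔴.syls := by
  refine List.prefix_iff_getElem?.2 fun i hi => ?_
  have hi' : i < 𝔴.syls.length := lt_of_lt_of_le hi hl
  rw [List.getElem?_eq_getElem hi', ← h i _ (List.getElem?_eq_getElem hi),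
    ← h' i _ (List.getElem?_eq_getElem hi')]

end Str

open Str

/-! ### The syllables that follow a string in the value of a term -/

theorem follows_of_step {p q : E → Syl E} {i : ℕ} {𝔳 𝔴 : A.Str} (h : Step p q i 𝔳 𝔴) :
    𝔳.Follows p 𝔴 := by
  obtain ⟨b, y, -, -, -, -, -, -, h1, h2, h3⟩ := h
  refine ⟨⟨h1.symm, h2.symm, h3 ▸ List.prefix_append _ _⟩, fun α hα => ⟨b, ?_⟩⟩
  rw [h3, List.getElem?_append_right (by rfl)] at hα
  simpa [len] using hα.symm

theorem follows_of_steps {p q : E → Syl E} {is : List ℕ} {𝔳 𝔴 : A.Str}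
    (h : Steps (Step p q) is 𝔳 𝔴) : 𝔳.Follows p 𝔴 := by
  induction is generalizing 𝔳 with
  | nil => obtain rfl : 𝔳 = 𝔴 := h; exact .refl p 𝔳
  | cons i is ih =>
    obtain ⟨𝔷, h1, h2⟩ := h
    exact (follows_of_step h1).trans (ih h2)

/-- If every application of `R` extends strings by a syllable in the range of `c`, then `𝔳` is followed
by such a syllable in the limit `⟨1, R⟩(𝔳)`. -/
theorem IsLimit.exists_eq {c : E → Syl E} {R : A.Str → A.Str → Prop} {𝔳 : A.Str}
    {W : ℕ → Syl E} (h : IsLimit R 𝔳 W) (hR : ∀ 𝔞 𝔟, R 𝔞 𝔟 → 𝔞.Follows c 𝔟) :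
    ∃ b, W 𝔳.len = c b := by
  obtain ⟨s, rfl, hs, hW, hlen⟩ := h
  have hf : ∀ n, (s 0).Follows c (s n) := fun n => by
    induction n with
    | zero => exact .refl c _
    | succ n ih => exact ih.trans (hR _ _ (hs n))
  obtain ⟨n, hn⟩ := hlen ((s 0).len + 1)
  have hget : (s n).syls[(s 0).len]? = some (s n).syls[(s 0).len] :=
    List.getElem?_eq_getElem hn
  rw [hW n _ _ hget]
  exact (hf n).2 _ hget

theorem IsLimit.agrees {R : A.Str → A.Str → Prop} {𝔳 : A.Str} {W : ℕ → Syl E}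
    (h : IsLimit R 𝔳 W) : 𝔳.Agrees W := by
  obtain ⟨s, rfl, -, hW, -⟩ := h
  exact hW 0

theorem Bracket.follows {c : E → Syl E} {R S : A.Str → A.Str → Prop} {𝔳 𝔶 : A.Str}
    (h : Bracket R S 𝔳 𝔶) (hS : ∀ 𝔞 𝔟, S 𝔞 𝔟 → 𝔞.Follows c 𝔟) : 𝔳.Follows c 𝔶 := by
  obtain ⟨⟨W, hSW, hRW⟩, -, hi, -⟩ := h
  obtain ⟨b, hb⟩ := hSW.exists_eq hS
  exact ⟨hi, fun α hα => ⟨b, by rw [← hRW.agrees _ _ hα, hb]⟩⟩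

theorem LTermVal.follows {τ : LTerm} {𝔳 𝔴 : A.Str} (h : A.LTermVal τ 𝔳 𝔴) :
    𝔳.Follows Syl.inv 𝔴 := by
  cases τ with
  | comp τ => exact follows_of_steps h
  | brac μ τ => exact Bracket.follows h fun _ _ => follows_of_steps

theorem LbarTermVal.follows {μ : LbarTerm} {𝔳 𝔴 : A.Str} (h : A.LbarTermVal μ 𝔳 𝔴) :
    𝔳.Follows Syl.dir 𝔴 := by
  cases μ with
  | comp μ => exact follows_of_steps h
  | brac τ μ => exact Bracket.follows h fun _ _ => follows_of_steps

/-! ### Extending strings on the right -/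

namespace Str

/-- If `𝔵𝔳` is a string, `𝔵` starts with an inverse syllable, and `𝔵` is followed by a direct
syllable in the `ℕ`-string `W`, then `𝔲𝔳` is a string for every initial part `𝔲` of `W`: a relation
that crosses the boundary to `𝔳` would consist of inverse syllables, and so it would end
within `𝔵`. -/
theorem exists_isConcat {W : ℕ → Syl E} {𝔵 𝔳 𝔴 𝔲 : A.Str} (h : 𝔵.IsConcat 𝔳 𝔴)
    (hx : 𝔵.Agrees W) (h0 : ∃ b, W 0 = .inv b) (hlen : ∃ a, W 𝔵.len = .dir a)
    (hb : 𝔲.base = 𝔵.base) (hs : 𝔲.sgn = 𝔵.sgn) (hu : 𝔲.Agrees W) :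
    ∃ 𝔲' : A.Str, 𝔲.IsConcat 𝔳 𝔲' := by
  obtain ⟨b₀, h0⟩ := h0
  obtain ⟨a₀, ha₀⟩ := hlen
  have hne : 0 < 𝔵.syls.length := by
    rw [Nat.pos_iff_ne_zero]
    intro hz
    have : 𝔵.len = 0 := hz
    rw [this, h0] at ha₀
    simp at ha₀
  have hhead : ∀ {𝔲 : A.Str}, 𝔲.Agrees W → ∀ α ∈ 𝔲.syls.head?, α = W 0 := fun hu α hα =>
    (hu 0 α (by rwa [← List.head?_eq_getElem?])).symm
  have hxhead : 𝔵.syls.head? = some (W 0) := by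
    rw [List.head?_eq_getElem?, List.getElem?_eq_getElem hne, hx 0 _ (List.getElem?_eq_getElem hne)]
  refine ⟨⟨𝔳.base, 𝔳.sgn, 𝔳.syls ++ 𝔲.syls, ?_, ?_, ?_⟩, by rw [h.1, hb], by rw [h.2.1, hs],
    rfl, rfl, rfl⟩
  · intro α hα
    by_cases hv : 𝔳.syls = []
    · have h1 : 𝔳.base = 𝔵.base := by simpa [endVertex, hv] using h.1
      have h2 : 𝔳.sgn = 𝔵.sgn := by simpa [endSgn, hv] using h.2.1
      rw [h1, h2, ← hb, ← hs]
      exact 𝔲.head_ok α (by simpa [hv] using hα)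
    · rw [List.head?_append_of_ne_nil _ hv] at hα
      exact 𝔳.head_ok α hα
  · have hc := 𝔴.chain_ok
    rw [h.2.2.2.2, List.isChain_append] at hc
    refine List.isChain_append.2 ⟨hc.1, 𝔲.chain_ok, fun α hα β hβ => ?_⟩
    rw [hhead hu β hβ]
    exact hc.2.2 α hα _ hxhead
  · intro r hr
    constructor
    · intro hinf
      cases hus : 𝔲.syls with
      | nil =>
        rw [hus, List.append_nil] at hinf
        exact (𝔳.no_rel r hr).1 hinf
      | cons α t =>
        obtain rfl : α = .inv b₀ := by rw [hhead hu α (by simp [hus]), h0]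
        rw [hus] at hinf
        rcases List.infix_or_infix_of_notMem hinf (by simp) with h' | h'
        · exact (𝔳.no_rel r hr).1 h'
        · refine (𝔲.no_rel r hr).1 ?_
          rw [hus]; exact List.infix_cons h'
    · intro hinf
      rcases Nat.le_total 𝔲.len 𝔵.len with hl | hl
      · refine (𝔴.no_rel r hr).2 (hinf.trans ?_)
        rw [h.2.2.2.2]
        exact ((List.prefix_append_right_inj _).2 (hu.prefix hx hl)).isInfix
      · obtain ⟨t, ht⟩ := hx.prefix hu hl
        cases t with
        | nil =>
          rw [← ht, List.append_nil, ← h.2.2.2.2] at hinf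
          exact (𝔴.no_rel r hr).2 hinf
        | cons α t =>
          obtain rfl : α = .dir a₀ := by
            rw [← ha₀]
            refine (hu _ _ ?_).symm
            rw [← ht, List.getElem?_append_right (by rfl)]
            simp [len]
          rw [← ht, ← List.append_assoc, ← h.2.2.2.2] at hinf
          rcases List.infix_or_infix_of_notMem hinf (by simp) with h' | h'
          · exact (𝔴.no_rel r hr).2 h'
          · refine (𝔲.no_rel r hr).2 ?_
            rw [← ht]
            exact h'.trans ((List.suffix_cons _ _).trans (List.suffix_append _ _)).isInfix

theorem Follows.isConcat {c : E → Syl E} {𝔞 𝔟 𝔳 𝔞' 𝔟' : A.Str} (h : 𝔞.Follows c 𝔟)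
    (ha : 𝔞.IsConcat 𝔳 𝔞') (hb : 𝔟.IsConcat 𝔳 𝔟') : 𝔞'.Follows c 𝔟' := by
  refine ⟨⟨ha.2.2.1.trans hb.2.2.1.symm, ha.2.2.2.1.trans hb.2.2.2.1.symm, ?_⟩, fun α hα => ?_⟩
  · rw [ha.2.2.2.2, hb.2.2.2.2]
    exact (List.prefix_append_right_inj _).2 h.1.2.2
  · refine h.2 α ?_
    have e : 𝔞'.len = 𝔳.syls.length + 𝔞.len := by simp [len, ha.2.2.2.2]
    rw [hb.2.2.2.2, List.getElem?_append_right (by omega), e, Nat.add_sub_cancel_left] at hα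
    exact hα

theorem IsConcat.endVertex_eq {𝔲 𝔳 𝔴 : A.Str} (h : 𝔲.IsConcat 𝔳 𝔴) :
    𝔴.endVertex = 𝔲.endVertex := by
  by_cases hu : 𝔲.syls = []
  · have : 𝔴.endVertex = 𝔳.endVertex := by
      simp [endVertex, h.2.2.2.2, h.2.2.1, hu]
    rw [this, h.1]; simp [endVertex, hu]
  · obtain ⟨α, hα⟩ := Option.ne_none_iff_exists'.1 (mt List.getLast?_eq_none_iff.1 hu)
    simp [endVertex, h.2.2.2.2, List.getLast?_append, hα]

theorem IsConcat.endSgn_eq {𝔲 𝔳 𝔴 : A.Str} (h : 𝔲.IsConcat 𝔳 𝔴) : 𝔴.endSgn = 𝔲.endSgn := by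
  by_cases hu : 𝔲.syls = []
  · have : 𝔴.endSgn = 𝔳.endSgn := by
      simp [endSgn, h.2.2.2.2, h.2.2.2.1, hu]
    rw [this, h.2.1]; simp [endSgn, hu]
  · obtain ⟨α, hα⟩ := Option.ne_none_iff_exists'.1 (mt List.getLast?_eq_none_iff.1 hu)
    simp [endSgn, h.2.2.2.2, List.getLast?_append, hα]

end Str

/-- A label does not change if strings are extended on the right. -/
theorem Labels.extend {τ : LTerm} {w : V} {j : ℤˣ} {𝔵 𝔟 𝔠 𝔳 𝔟' 𝔠' : A.Str}
    (h : A.Labels τ w j 𝔵 𝔟 𝔠) (hb : 𝔟.IsConcat 𝔳 𝔟') (hc : 𝔠.IsConcat 𝔳 𝔠') :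
    A.Labels τ w j 𝔵 𝔟' 𝔠' := by
  obtain ⟨h1, h2, h3, h4, h5, h6⟩ := h
  refine ⟨h1, hb.endVertex_eq.trans h2, hb.endSgn_eq.trans h3,
    hc.2.2.1.trans hb.2.2.1.symm, hc.2.2.2.1.trans hb.2.2.2.1.symm, ?_⟩
  rw [hc.2.2.2.2, h6, ← List.append_assoc, ← hb.2.2.2.2]

theorem Labels.follows {τ : LTerm} {w : V} {j : ℤˣ} {𝔵 𝔳 𝔴 : A.Str}
    (h : A.Labels τ w j 𝔵 𝔳 𝔴) : 𝔳.Follows Syl.inv 𝔴 := by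
  obtain ⟨hx, -, -, h1, h2, h3⟩ := h
  refine ⟨⟨h1.symm, h2.symm, h3 ▸ List.prefix_append _ _⟩, fun α hα => ?_⟩
  refine (LTermVal.follows hx).2 α ?_
  rw [h3, List.getElem?_append_right (by rfl)] at hα
  simpa [len, lazy] using hα

/-! ### Canonical maps between string modules -/

namespace Str

section Maps

variable (k : Type u) [Field k]

/-- For a factor substring `𝔳` of `𝔴`, the map `M(𝔴) → M(𝔳)` given by `z_m ↦ z_m` is the projection,
as `𝔳.z k m = 0` for `m > 𝔳.len`. -/
theorem inclusionₗ_genAct_of_follows_dir {𝔳 𝔴 : A.Str} (h : 𝔳.Follows Syl.dir 𝔴) (g : V ⊕ E) :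
    inclusionₗ k 𝔴 𝔳 ∘ₗ 𝔴.genAct k g = 𝔳.genAct k g ∘ₗ inclusionₗ k 𝔴 𝔳 := by
  classical
  have hz : ∀ m, inclusionₗ k 𝔴 𝔳 (𝔴.z k m) = 𝔳.z k m := fun m => by
    by_cases hm : m < 𝔴.len + 1
    · exact inclusionₗ_z k 𝔴 𝔳 hm
    · have := h.1.len_le
      rw [z, dif_neg hm, map_zero, z, dif_neg (by omega)]
  refine end_ext k fun m => ?_
  rw [LinearMap.comp_apply, LinearMap.comp_apply, hz]
  cases g with
  | inl w =>
    rw [genAct_inl_z, genAct_inl_z, apply_ite (inclusionₗ k 𝔴 𝔳), map_zero, hz]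
    by_cases hm : m < 𝔳.len + 1
    · rw [h.1.vtx hm]
    · simp [z, hm]
  | inr b =>
    rw [genAct_inr_z, genAct_inr_z, map_add, apply_ite (inclusionₗ k 𝔴 𝔳),
      apply_ite (inclusionₗ k 𝔴 𝔳), map_zero, hz, hz]
    congr 1
    · rcases Nat.lt_or_ge m 𝔳.len with hlt | hge
      · rw [h.1.getElem? hlt]
      · simp [z, show ¬ m < 𝔳.len by omega]
    · rcases Nat.lt_or_ge (m - 1) 𝔳.len with hlt | hge
      · rw [h.1.getElem? hlt]
      · rw [if_neg (c := 0 < m ∧ 𝔳.syls[m - 1]? = some (.inv b))]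
        · split_ifs with hc
          · rcases Nat.eq_or_lt_of_le hge with he | hgt
            · obtain ⟨a, ha⟩ := h.2 (.inv b) (by rw [he]; exact hc.2)
              simp at ha
            · simp [z, show ¬ m - 1 < 𝔳.len + 1 by omega]
          · rfl
        · rw [List.getElem?_eq_none (by unfold len at hge; omega)]
          simp

theorem inclusionₗ_comp {𝔲 𝔳 𝔴 : A.Str} (h : 𝔲.len ≤ 𝔳.len) :
    inclusionₗ k 𝔳 𝔴 ∘ₗ inclusionₗ k 𝔲 𝔳 = inclusionₗ k 𝔲 𝔴 := by
  refine end_ext k fun m => ?_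
  by_cases hm : m < 𝔲.len + 1
  · rw [LinearMap.comp_apply, inclusionₗ_z k 𝔲 𝔳 hm, inclusionₗ_z k 𝔳 𝔴 (by omega),
      inclusionₗ_z k 𝔲 𝔴 hm]
  · simp [z, hm]

variable [Fintype V]

theorem comp_rep_eq_of_comp_genAct_eq {𝔳 𝔴 : A.Str} {f : 𝔳.Mod k →ₗ[k] 𝔴.Mod k}
    (h : ∀ g, f ∘ₗ 𝔳.genAct k g = 𝔴.genAct k g ∘ₗ f) (a : A.Alg k) :
    f ∘ₗ 𝔳.rep k a = 𝔴.rep k a ∘ₗ f := by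
  obtain ⟨a, rfl⟩ := RingQuot.mkAlgHom_surjective k _ a
  simp only [rep, RingQuot.liftAlgHom_mkAlgHom_apply]
  induction a using FreeAlgebra.induction with
  | grade0 r => ext x; simp
  | grade1 g => simpa using h g
  | mul a b ha hb =>
    rw [map_mul, map_mul, Module.End.mul_eq_comp, Module.End.mul_eq_comp, ← LinearMap.comp_assoc,
      ha, LinearMap.comp_assoc, hb, LinearMap.comp_assoc]
  | add a b ha hb => rw [map_add, map_add, LinearMap.comp_add, LinearMap.add_comp, ha, hb]

/-- The canonical projection `M(𝔴) → M(𝔳)` for a factor substring `𝔳` of `𝔴` that is an initial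
substring of `𝔴`: it sends `z_m` to `z_m` for `0 ≤ m ≤ 𝔳.len`, and to `0` for larger `m`. -/
noncomputable def canonicalProjection {𝔳 𝔴 : A.Str} (h : 𝔳.Follows Syl.dir 𝔴) :
    𝔴.stringModule k ⟶ 𝔳.stringModule k :=
  ObjectProperty.homMk (ModuleCat.ofHom
    { toFun := inclusionₗ k 𝔴 𝔳
      map_add' := map_add _
      map_smul' := fun a x => LinearMap.congr_fun
        (comp_rep_eq_of_comp_genAct_eq k (inclusionₗ_genAct_of_follows_dir k h) a) x })

variable {k} in
theorem stringModule_hom_ext {𝔳 𝔴 : A.Str} {f g : 𝔳.stringModule k ⟶ 𝔴.stringModule k}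
    (h : ∀ x : 𝔳.Mod k, f.hom.hom x = g.hom.hom x) : f = g :=
  ObjectProperty.hom_ext _ (ModuleCat.hom_ext (LinearMap.ext h))

theorem canonicalInclusion_comp {𝔲 𝔳 𝔴 : A.Str} (h : 𝔲.IsInitialImage 𝔳)
    (h' : 𝔳.IsInitialImage 𝔴) (h'' : 𝔲.IsInitialImage 𝔴) :
    canonicalInclusion k h ≫ canonicalInclusion k h' = canonicalInclusion k h'' :=
  stringModule_hom_ext fun x => LinearMap.congr_fun (inclusionₗ_comp k h.1.len_le) x

theorem canonicalInclusion_comp_projection {𝔲 𝔳 𝔴 : A.Str} (h : 𝔲.IsInitialImage 𝔴)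
    (h' : 𝔳.Follows Syl.dir 𝔴) (h'' : 𝔲.IsInitialImage 𝔳) :
    canonicalInclusion k h ≫ canonicalProjection k h' = canonicalInclusion k h'' :=
  stringModule_hom_ext fun x => LinearMap.congr_fun (inclusionₗ_comp k h.1.len_le) x

theorem not_isIso_canonicalInclusion {𝔳 𝔴 : A.Str} (h : 𝔳.IsInitialImage 𝔴)
    (hlt : 𝔳.len < 𝔴.len) : ¬ IsIso (canonicalInclusion k h) := by
  intro hiso
  have hzero : 𝔴.coeff k 𝔴.len ∘ₗ inclusionₗ k 𝔳 𝔴 = 0 := by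
    refine end_ext k fun m => ?_
    by_cases hm : m < 𝔳.len + 1
    · rw [LinearMap.comp_apply, inclusionₗ_z k 𝔳 𝔴 hm, coeff_z k 𝔴 _ (by omega),
        if_neg (by omega), LinearMap.zero_apply]
    · simp [z, hm]
  let x : 𝔳.Mod k := (inv (canonicalInclusion k h)).hom.hom (𝔴.z k 𝔴.len)
  have hx : inclusionₗ k 𝔳 𝔴 x = 𝔴.z k 𝔴.len := by
    have := IsIso.inv_hom_id (canonicalInclusion k h)
    exact congrArg (fun f : 𝔴.stringModule k ⟶ 𝔴.stringModule k => f.hom.hom (𝔴.z k 𝔴.len)) this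
  have := LinearMap.congr_fun hzero x
  rw [LinearMap.comp_apply, hx, coeff_z k 𝔴 _ (by omega), if_pos rfl] at this
  exact one_ne_zero this

theorem radical_canonicalInclusion {𝔳 𝔴 : A.Str} (h : 𝔳.IsInitialImage 𝔴)
    (hlt : 𝔳.len < 𝔴.len) : A.radical k (canonicalInclusion k h) :=
  fun _ _ hW => hW _ ⟨isIndec_stringModule k 𝔳, isIndec_stringModule k 𝔴,
    not_isIso_canonicalInclusion k h hlt⟩

end Maps

end Str

/-! ### Factorizations of the inclusions labelled by a recursive term -/

section Recursion

variable (k : Type u) [Field k] [Fintype V]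

/-- If an ideal contains all inclusions labelled by a recursive term, then for each `n` every such
inclusion factors through a composition of `n + 1` morphisms of the ideal. -/
theorem IsRecursive.powIdeal_mem {τ : LTerm} {w : V} {j : ℤˣ} {𝔵 : A.Str}
    (hrec : A.IsRecursive τ w j 𝔵) {I : MorphismProperty (A.FinMod k)} (hI : IsCatIdeal I)
    (hmem : ∀ (𝔭 𝔮 : A.Str) (h : 𝔭.IsInitialImage 𝔮), A.Labels τ w j 𝔵 𝔭 𝔮 →
      I (canonicalInclusion k h))
    (n : ℕ) {𝔳 𝔴 : A.Str} (h : 𝔳.IsInitialImage 𝔴) (hlab : A.Labels τ w j 𝔵 𝔳 𝔴) :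
    powIdeal I (n + 1) (canonicalInclusion k h) := by
  obtain ⟨-, τ₁, τ₂, μ, ⟨W, hS, hR⟩, -, hi, -⟩ := hrec
  -- The `ℕ`-string `W` begins with an inverse syllable, and `𝔵` is followed in it by a direct one.
  have hSf : ∀ 𝔞 𝔡 : A.Str, (∃ 𝔟 𝔠, A.LTermVal τ₂ 𝔞 𝔟 ∧ A.Labels τ w j 𝔵 𝔟 𝔠 ∧
      A.LTermVal τ₁ 𝔠 𝔡) → 𝔞.Follows Syl.inv 𝔡 := by
    rintro 𝔞 𝔡 ⟨𝔟, 𝔠, h1, h2, h3⟩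
    exact (LTermVal.follows h1).trans (h2.follows.trans (LTermVal.follows h3))
  have h0 : ∃ b, W 0 = .inv b := hS.exists_eq hSf
  have hdir : ∃ a, W 𝔵.len = .dir a := hR.exists_eq fun _ _ => LbarTermVal.follows
  have hconcat : ∀ 𝔲 : A.Str, 𝔲.base = w → 𝔲.sgn = j → 𝔲.Agrees W →
      ∃ 𝔲' : A.Str, 𝔲.IsConcat 𝔳 𝔲' := fun 𝔲 hb hs hu =>
    exists_isConcat hlab.2 hR.agrees h0 hdir (hb.trans hi.1) (hs.trans hi.2.1) hu
  have hxW : 𝔵.Agrees W := hR.agrees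
  obtain ⟨s, hs0, hs, hsW, hslen⟩ := hS
  have hsf : ∀ m n, m ≤ n → (s m).Follows Syl.inv (s n) := fun m n hmn => by
    induction n, hmn using Nat.le_induction with
    | base => exact .refl _ _
    | succ n _ ih => exact ih.trans (hSf _ _ (hs n))
  have hsb : ∀ n, (s n).base = w ∧ (s n).sgn = j := fun n => by
    have := (hsf 0 n (Nat.zero_le n)).1
    rw [hs0] at this
    exact ⟨this.1.symm, this.2.1.symm⟩
  choose t ht using fun n => hconcat (s n) (hsb n).1 (hsb n).2 (hsW n)
  have htf : ∀ m n, m ≤ n → (t m).IsInitialImage (t n) := fun m n hmn =>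
    (hsf m n hmn).isConcat (ht m) (ht n)
  have ht0 : t 0 = 𝔳 := by
    have := ht 0
    rw [hs0] at this
    exact Str.ext this.2.2.1 this.2.2.2.1 (this.2.2.2.2.trans (List.append_nil _))
  -- `t n` is the string `s_n 𝔳`, where `s_0 = 1_{(w,j)}, s_1, s_2, …` are the iterates with limit `W`.
  -- Each inclusion `M(s_n 𝔳) → M(s_{n+1} 𝔳)` passes through an inclusion with the same label.
  have hstep : ∀ n, I (canonicalInclusion k (htf n (n + 1) n.le_succ)) := fun n => by
    obtain ⟨𝔟, 𝔠, h1, h2, h3⟩ := hs n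
    have hc := (LTermVal.follows h3).1
    have hb := h2.follows.1.trans hc
    obtain ⟨𝔠', hc'⟩ := hconcat 𝔠 (hc.1.trans (hsb (n + 1)).1) (hc.2.1.trans (hsb (n + 1)).2)
      (Agrees.of_isInitial (hsW (n + 1)) hc)
    obtain ⟨𝔟', hb'⟩ := hconcat 𝔟 (hb.1.trans (hsb (n + 1)).1) (hb.2.1.trans (hsb (n + 1)).2)
      (Agrees.of_isInitial (hsW (n + 1)) hb)
    have f1 : (t n).IsInitialImage 𝔟' := (LTermVal.follows h1).isConcat (ht n) hb'
    have f2 : 𝔟'.IsInitialImage 𝔠' := h2.follows.isConcat hb' hc'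
    have f3 : 𝔠'.IsInitialImage (t (n + 1)) := (LTermVal.follows h3).isConcat hc' (ht (n + 1))
    have f4 : (t n).IsInitialImage 𝔠' := Follows.trans f1 f2
    rw [← canonicalInclusion_comp k f4 f3, ← canonicalInclusion_comp k f1 f2]
    exact hI.postcomp _ _ (hI.precomp _ _ (hmem _ _ f2 (h2.extend hb' hc')))
  have hfold : ∀ n, nFold I (n + 1) (canonicalInclusion k (htf 0 (n + 1) (Nat.zero_le _))) :=
    fun n => by
      induction n with
      | zero => exact hstep 0
      | succ n ih => exact ⟨_, _, _, ih, hstep (n + 1), canonicalInclusion_comp k _ _ _⟩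
  -- For large `N`, the string `𝔵` is an initial part of `s_N`, and so `M(𝔵𝔳)` is a factor module
  -- of `M(s_N 𝔳)`.
  obtain ⟨N, hN⟩ := hslen 𝔵.len
  have hNM : 𝔵.len ≤ (s (N + (n + 1))).len := hN.trans (hsf N _ (Nat.le_add_right _ _)).1.len_le
  have hproj : 𝔵.Follows Syl.dir (s (N + (n + 1))) := by
    refine ⟨⟨hi.1.symm.trans (hsb _).1.symm, hi.2.1.symm.trans (hsb _).2.symm,
      hxW.prefix (hsW _) hNM⟩, fun α hα => ?_⟩
    rw [← hsW _ _ _ hα]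
    exact hdir
  have hproj' : 𝔴.Follows Syl.dir (t (N + (n + 1))) := hproj.isConcat hlab.2 (ht _)
  have hG := genIdeal_isCatIdeal (nFold I (n + 1))
  subst ht0
  rw [← canonicalInclusion_comp_projection k (htf 0 (N + (n + 1)) (Nat.zero_le _)) hproj' h,
    ← canonicalInclusion_comp k (htf 0 (n + 1) (Nat.zero_le _))
      (htf (n + 1) (N + (n + 1)) (by omega))]
  exact hG.postcomp _ _ (hG.postcomp _ _ fun _ _ hle => hle _ (hfold n))

/-- The inclusions labelled by a recursive term lie in all transfinite powers of the radical. -/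
theorem IsRecursive.ordPow_mem {τ : LTerm} {w : V} {j : ℤˣ} {𝔵 : A.Str}
    (hrec : A.IsRecursive τ w j 𝔵) (ν : Ordinal.{u}) {𝔳 𝔴 : A.Str} (h : 𝔳.IsInitialImage 𝔴)
    (hlab : A.Labels τ w j 𝔵 𝔳 𝔴) : ordPow (A.radical k) ν (canonicalInclusion k h) := by
  induction ν using WellFoundedLT.induction generalizing 𝔳 𝔴 with
  | _ ν ih =>
  obtain ⟨m, hm⟩ := Ordinal.lt_omega0.1 (Ordinal.mod_lt ν Ordinal.omega0_ne_zero)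
  have hν := Ordinal.div_add_mod ν Ordinal.omega0
  rw [hm] at hν
  rcases eq_or_ne (ν / Ordinal.omega0) 0 with hq | hq
  · rw [hq, mul_zero, zero_add] at hν
    rw [← hν, ordPow_nat]
    cases m with
    | zero => exact fun _ _ hle => hle _ trivial
    | succ m =>
      refine hrec.powIdeal_mem k (genIdeal_isCatIdeal _) (fun 𝔭 𝔮 hpq hl => ?_) m h hlab
      refine radical_canonicalInclusion k hpq ?_
      have hpos : 0 < 𝔵.syls.length := by
        obtain ⟨-, τ₁, τ₂, μ, -, -, hi, hne⟩ := hrec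
        by_contra hlen
        exact hne (hi.eq_of_len_le (by unfold len; omega))
      simp [len, hl.2.2.2.2.2, hpos]
  · have hlim : Order.IsSuccLimit (Ordinal.omega0 * (ν / Ordinal.omega0)) :=
      Ordinal.isSuccLimit_mul_left Ordinal.isSuccLimit_omega0 (pos_iff_ne_zero.2 hq)
    cases m with
    | zero =>
      rw [Nat.cast_zero, add_zero] at hν
      rw [hν] at hlim
      rw [ordPow_limit _ hlim]
      exact fun ν' hν' => ih ν' hν' h hlab
    | succ m =>
      have hlt : Ordinal.omega0 * (ν / Ordinal.omega0) < ν := by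
        conv_rhs => rw [← hν]
        exact lt_add_of_pos_right _ (by exact_mod_cast Nat.succ_pos m)
      rw [← hν, ordPow_limit_add _ hlim]
      exact hrec.powIdeal_mem k (ordPow_isCatIdeal _ _) (fun 𝔭 𝔮 hpq hl => ih _ hlt hpq hl)
        (m + 1) h hlab

end Recursion

end StringAlgebra

theorem lemma4p1p5 {k : Type u} [Field k] [IsAlgClosed k] {V E : Type v} [Fintype V] [Finite E]
    (A : StringAlgebra V E)
    -- a term `τ(v,j)`, with value `𝔵 = τ(1_{(v,j)})`
    (τ : LTerm) (v : V) (j : ℤˣ) (𝔵 : A.Str)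
    -- the canonical inclusion `M(𝔳) → M(𝔴)` between distinct string modules
    {𝔳 𝔴 : A.Str} (h : 𝔳.IsInitialImage 𝔴) (hne : 𝔳 ≠ 𝔴)
    -- is labelled by this term, which is recursive
    (hlab : A.Labels τ v j 𝔵 𝔳 𝔴) (hrec : A.IsRecursive τ v j 𝔵) :
    A.rk (StringAlgebra.Str.canonicalInclusion k h) = ⊤ :=
  if_pos fun ν => hrec.ordPow_mem k ν h hlab
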